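/- Let $d\ge 1$, let $\gamma=(\gamma(x))_{x\in\mathbb Z^d}$ be independent fair coin-flips, that is, let $\mathbb P$ be the product measure with parameter $\tfrac12$ on $\{0,1\}^{\mathbb Z^d}$ with its product $\sigma$-algebra. A matching on $\gamma$ is a bijection $\phi:\mathbb Z^d\to\mathbb Z^d$ with $\phi\circ\phi=\mathrm{id}$ that maps every site $x$ with $\gamma(x)=1$ to a site $y$ with $\gamma(y)=0$ and vice versa. A matching rule is a measurable map $\Phi:\{0,1\}^{\mathbb Z^d}\times\mathbb Z^d\to\mathbb Z^d$ such that $\Phi(\gamma,\cdot)$ is a matching on $\gamma$ for $\mathbb P$-almost every $\gamma$. It is translation-equivariant if for $\mathbb P$-almost every $\gamma$ one has $\Phi(\theta^z\gamma,x+z)=\Phi(\gamma,x)+z$ for all $x,z\in\mathbb Z^d$, where $\theta^z\gamma(x)=\gamma(x-z)$. Then there exist a translation-equivariant matching rule $\Phi$ and a constant $c=c(d)\in(0,\infty)$ such that the distance $Z(\gamma)=\|\Phi(\gamma,0)\|_\infty$ from the origin to its partner satisfies $$\mathbb P(Z>r)\le c\,r^{-\beta'}(\log r)^2\qquad\text{for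 all } r\ge 2,\qquad\text{where }\beta'=\beta'(d)=\frac{1}{1+2/d}.$$ -/

import Mathlib

open MeasureTheory

/-- The sites of the lattice `ℤ^d`; its norm `‖x‖` is the sup norm `max_i |x i|`. -/
abbrev Site (d : ℕ) : Type := Fin d → ℤ

/-- The coin-flip configurations `{0,1}^(ℤ^d)`, with the product sigma-algebra
(`true` stands for `1`, `false` for `0`). -/
abbrev Config (d : ℕ) : Type := Site d → Bool

/-- The law of independent fair coin-flips at the sites of `ℤ^d`. -/
noncomputable def coinFlips (d : ℕ) : Measure (Config d) :=
  Measure.infinitePi fun _ : Site d => (PMF.uniformOfFintype Bool).toMeasure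

/-- The translation `θ^z` of configurations: `(θ^z γ)(x) = γ(x - z)`. -/
def shiftConfig {d : ℕ} (z : Site d) (γ : Config d) : Config d := fun x => γ (x - z)

/-- `φ` is a matching on `γ`: an involutive bijection of `ℤ^d` that exchanges ones and zeros. -/
structure IsMatching {d : ℕ} (γ : Config d) (φ : Site d → Site d) : Prop where
  bijective : Function.Bijective φ
  one_to_zero : ∀ x, γ x = true → γ (φ x) = false
  zero_to_one : ∀ x, γ x = false → γ (φ x) = true
  comp_self : φ ∘ φ = id

/-- A matching rule: a (jointly) measurable map which for almost every configuration is a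
matching on that configuration. -/
structure IsMatchingRule {d : ℕ} (Φ : Config d → Site d → Site d) : Prop where
  measurable : Measurable (Function.uncurry Φ)
  isMatching : ∀ᵐ γ ∂(coinFlips d), IsMatching γ (Φ γ)

/-- `Φ` commutes with translations, for almost every configuration. -/
def IsTranslationEquivariant {d : ℕ} (Φ : Config d → Site d → Site d) : Prop :=
  ∀ᵐ γ ∂(coinFlips d), ∀ z x : Site d, Φ (shiftConfig z γ) (x + z) = Φ γ x + z

/-- The distance `Z_Φ(γ)` from the origin to its partner. -/
noncomputable def partnerDist {d : ℕ} (Φ : Config d → Site d → Site d) (γ : Config d) : ℝ :=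
  ‖Φ γ 0‖

/-! Match inside the cells of a nested random partition of the lattice, one scale `K ^ k` after
another. In each cell, ones are paired with zeros until only one colour is left, so the number of
leftovers is at most the absolute discrepancy of the cell. If that is about `k * (K ^ k) ^ (d - β)`
for a cell of volume of order `(K ^ k) ^ d`, then by translation invariance a site is unmatched
after level `k` with probability about `k * (K ^ k) ^ (-β)`. A site matched by then has its partner
within `4 * K ^ k`, and this is the tail bound.

The partition must be equivariant. Almost every configuration is aperiodic, so finite patterns of
coins single out sites locally, and a greedy choice along an enumeration of the patterns gives a
maximal separated set (`exists_boxClustering`). Sending each site to the least nearby centre gives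
cells that are a box minus boundedly many boxes. Composing the scales (`coarse`) makes the cells
nested but ragged.

The discrepancy of the ragged cells is controlled in `abs_disc_cell_le`. A ragged cell of level `j +
1` differs from a box cell only in the cells of level `j` cut by its boundary, and there are `O(K ^
(d - 1))` of these. For `β < 1` and `K` large their total is at most half of the target, by
induction. The box cell itself has discrepancy about the square root of its volume, which is
admissible since `β ≤ d / 2`. Cells depend on the coins, so Hoeffding's inequality is applied to all
sets that could arise from the relevant cuts by boxes (`testSets`). There are `exp (O(k ^ 2))` of
them, and a union bound costs only the factor `k`, that is, one logarithm of `r`. -/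

open ProbabilityTheory

/-! ### Coin flips: concentration and translation invariance -/

/-- The sign `±1` of the coin at `x`. -/
def spin {d : ℕ} (γ : Config d) (x : Site d) : ℝ := if γ x = true then 1 else -1

/-- The discrepancy (ones minus zeros) of a finite set of sites. -/
def disc {d : ℕ} (γ : Config d) (A : Finset (Site d)) : ℝ := ∑ x ∈ A, spin γ x

theorem abs_spin {d : ℕ} (γ : Config d) (x : Site d) : |spin γ x| = 1 := by
  unfold spin; split_ifs <;> simp

instance instIsProbabilityMeasureCoinFlips (d : ℕ) : IsProbabilityMeasure (coinFlips d) := by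
  unfold coinFlips; infer_instance

theorem measurable_spin {d : ℕ} (x : Site d) : Measurable fun γ : Config d => spin γ x := by
  have : Measurable fun b : Bool => if b = true then (1 : ℝ) else -1 := measurable_of_countable _
  exact this.comp (measurable_pi_apply x)

theorem iIndepFun_spin (d : ℕ) :
    iIndepFun (fun (x : Site d) (γ : Config d) => spin γ x) (coinFlips d) :=
  iIndepFun_infinitePi (P := fun _ : Site d => (PMF.uniformOfFintype Bool).toMeasure)
    (X := fun _ (b : Bool) => if b = true then (1 : ℝ) else -1)
    (fun _ => measurable_of_countable _)

theorem integral_spin {d : ℕ} (x : Site d) : ∫ γ, spin γ x ∂(coinFlips d) = 0 := by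
  have h := (measurePreserving_eval_infinitePi
    (fun _ : Site d => (PMF.uniformOfFintype Bool).toMeasure) x)
  have h2 := integral_map (μ := coinFlips d) (φ := Function.eval x) h.measurable.aemeasurable
    (f := fun b : Bool => if b = true then (1 : ℝ) else -1)
    (measurable_of_countable _).aestronglyMeasurable
  have h3 : Measure.map (Function.eval x) (coinFlips d) =
    (PMF.uniformOfFintype Bool).toMeasure := h.map_eq
  rw [h3, PMF.integral_eq_sum] at h2
  change _ = ∫ γ, spin γ x ∂(coinFlips d) at h2
  rw [← h2]
  simp

theorem hasSubgaussianMGF_spin {d : ℕ} (x : Site d) :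
    HasSubgaussianMGF (fun γ : Config d => spin γ x) 1 (coinFlips d) := by
  have h := hasSubgaussianMGF_of_mem_Icc_of_integral_eq_zero (a := -1) (b := 1)
    (μ := coinFlips d) (measurable_spin x).aemeasurable
    (Filter.Eventually.of_forall fun γ => abs_le.1 (abs_spin γ x).le) (integral_spin x)
  convert h using 1
  ext
  norm_num

theorem measureReal_le_disc {d : ℕ} (A : Finset (Site d)) {t : ℝ} (ht : 0 ≤ t) :
    (coinFlips d).real {γ | t ≤ disc γ A} ≤ Real.exp (-t ^ 2 / (2 * A.card)) := by
  have h := HasSubgaussianMGF.measure_sum_ge_le_of_iIndepFun (iIndepFun_spin d) (c := fun _ => 1)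
    (s := A) (fun x _ => hasSubgaussianMGF_spin x) ht
  simpa [disc] using h

theorem measureReal_disc_le {d : ℕ} (A : Finset (Site d)) {t : ℝ} (ht : 0 ≤ t) :
    (coinFlips d).real {γ | disc γ A ≤ -t} ≤ Real.exp (-t ^ 2 / (2 * A.card)) := by
  have hi : iIndepFun (fun (x : Site d) (γ : Config d) => -spin γ x) (coinFlips d) :=
    (iIndepFun_spin d).comp (fun _ r => -r) (fun _ => measurable_neg)
  have h := HasSubgaussianMGF.measure_sum_ge_le_of_iIndepFun hi (c := fun _ => 1)
    (s := A) (fun x _ => (hasSubgaussianMGF_spin x).neg) ht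
  simpa [disc, le_neg] using h

/-- Hoeffding's inequality for the discrepancy of a finite set. -/
theorem measureReal_abs_disc_gt {d : ℕ} (A : Finset (Site d)) {l : ℝ} (hl : 0 ≤ l) :
    (coinFlips d).real {γ | l * Real.sqrt A.card < |disc γ A|} ≤ 2 * Real.exp (-l ^ 2 / 2) := by
  rcases A.eq_empty_or_nonempty with rfl | hA
  · simp [disc]; positivity
  have hc : (0 : ℝ) < A.card := by exact_mod_cast hA.card_pos
  have ht : 0 ≤ l * Real.sqrt A.card := by positivity
  have hs : {γ : Config d | l * Real.sqrt A.card < |disc γ A|} ⊆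
      {γ | l * Real.sqrt A.card ≤ disc γ A} ∪ {γ | disc γ A ≤ -(l * Real.sqrt A.card)} := by
    intro γ hγ
    change l * Real.sqrt A.card < |disc γ A| at hγ
    rcases lt_abs.1 hγ with h | h
    · exact Or.inl h.le
    · exact Or.inr (show disc γ A ≤ _ by linarith)
  have he : -(l * Real.sqrt A.card) ^ 2 / (2 * A.card) = -l ^ 2 / 2 := by
    rw [mul_pow, Real.sq_sqrt hc.le]; field_simp
  have h1 := measureReal_le_disc A ht
  have h2 := measureReal_disc_le A ht
  rw [he] at h1 h2
  calc _ ≤ _ := measureReal_mono hs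
    _ ≤ _ := measureReal_union_le _ _
    _ ≤ _ := by linarith

theorem measurable_disc {d : ℕ} (A : Finset (Site d)) :
    Measurable fun γ : Config d => disc γ A :=
  Finset.measurable_sum _ fun x _ => measurable_spin x

theorem measurable_shiftConfig {d : ℕ} (z : Site d) :
    Measurable (shiftConfig z : Config d → Config d) :=
  measurable_pi_lambda _ fun _ => measurable_pi_apply _

theorem map_shiftConfig {d : ℕ} (z : Site d) :
    (coinFlips d).map (shiftConfig z) = coinFlips d :=
  Measure.map_infinitePi_infinitePi_of_inj
    (P := fun _ : Site d => (PMF.uniformOfFintype Bool).toMeasure)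
    (f := fun x : Site d => x - z) (sub_left_injective)

/-! ### Almost sure aperiodicity -/

/-- No nontrivial translation fixes the configuration. -/
def Aperiodic {d : ℕ} (γ : Config d) : Prop := ∀ z : Site d, z ≠ 0 → ∃ u, γ (u - z) ≠ γ u

/-- A period `z` forces equal coins at all multiples of `z`. The discrepancy of `n + 1` of these is
then extremal, which Hoeffding makes exponentially unlikely in `n`. -/
theorem measureReal_periodic {d : ℕ} {z : Site d} (hz : z ≠ 0) :
    (coinFlips d).real {γ | ∀ u, γ (u - z) = γ u} = 0 := by
  have key : ∀ n : ℕ, (coinFlips d).real {γ | ∀ u, γ (u - z) = γ u} ≤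
      2 * Real.exp (-((n + 1 : ℕ) : ℝ) / 8) := by
    intro n
    have hinj : Function.Injective fun m : ℕ => m • z := by
      intro a b hab
      obtain ⟨i, hi⟩ := Function.ne_iff.1 hz
      have := congrFun hab i
      simp only [Pi.smul_apply, nsmul_eq_mul, Pi.zero_apply] at this hi
      exact_mod_cast mul_right_cancel₀ hi this
    set A : Finset (Site d) := (Finset.range (n + 1)).image fun m : ℕ => m • z with hA
    have hcard : A.card = n + 1 := by
      rw [hA, Finset.card_image_of_injective _ hinj, Finset.card_range]
    have hpos : (0 : ℝ) < ((n + 1 : ℕ) : ℝ) := by positivity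
    -- This choice of `l` puts the threshold at `(n + 1) / 2`, strictly below the value `n + 1`
    -- forced by periodicity.
    have h := measureReal_abs_disc_gt A (l := Real.sqrt (n + 1 : ℕ) / 2) (by positivity)
    rw [hcard, div_pow, Real.sq_sqrt hpos.le] at h
    have hsub : {γ : Config d | ∀ u, γ (u - z) = γ u} ⊆
        {γ | Real.sqrt (n + 1 : ℕ) / 2 * Real.sqrt (n + 1 : ℕ) < |disc γ A|} := by
      intro γ hγ
      have hconst : ∀ m : ℕ, spin γ (m • z) = spin γ 0 := by
        intro m
        induction m with
        | zero => simp
        | succ m ih =>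
          rw [← ih]
          have := hγ ((m + 1) • z)
          rw [succ_nsmul, add_sub_cancel_right] at this
          simp only [spin, succ_nsmul, this]
      have hd : disc γ A = (n + 1 : ℕ) * spin γ 0 := by
        rw [disc, hA, Finset.sum_image fun a _ b _ h => hinj h]
        rw [Finset.sum_congr rfl fun m _ => hconst m]
        simp
      change _ < |disc γ A|
      rw [hd, abs_mul, abs_spin, Nat.abs_cast]
      rw [div_mul_eq_mul_div, Real.mul_self_sqrt hpos.le]
      linarith
    refine (measureReal_mono hsub).trans (h.trans_eq ?_)
    congr 2
    ring
  have hlim : Filter.Tendsto (fun n : ℕ => 2 * Real.exp (-((n + 1 : ℕ) : ℝ) / 8)) Filter.atTop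
      (nhds (2 * 0)) := by
    refine Filter.Tendsto.const_mul _ (Real.tendsto_exp_atBot.comp ?_)
    have := (tendsto_natCast_atTop_atTop (R := ℝ)).comp (Filter.tendsto_add_atTop_nat 1)
    exact (Filter.tendsto_neg_atTop_atBot.comp this).atBot_div_const (by norm_num)
  rw [mul_zero] at hlim
  exact le_antisymm (ge_of_tendsto' hlim key) measureReal_nonneg

theorem ae_aperiodic (d : ℕ) : ∀ᵐ γ ∂(coinFlips d), Aperiodic γ := by
  unfold Aperiodic
  rw [ae_all_iff]
  intro z
  by_cases hz : z = 0
  · simp [hz]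
  have h := measureReal_periodic hz
  rw [measureReal_eq_zero_iff] at h
  rw [ae_iff]
  convert h using 2
  ext γ
  simp [hz]

/-! ### Equivariant separated sets and box clusterings -/

/-- `x` and `y` are at sup-distance less than `L`. -/
def Near {d : ℕ} (L : ℤ) (x y : Site d) : Prop := ∀ i, |x i - y i| < L

theorem Near.symm {d : ℕ} {L : ℤ} {x y : Site d} (h : Near L x y) : Near L y x :=
  fun i => by rw [abs_sub_comm]; exact h i

theorem near_self {d : ℕ} {L : ℤ} (hL : 0 < L) (x : Site d) : Near L x x :=
  fun i => by simpa using hL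

theorem Near.trans {d : ℕ} {L M : ℤ} {x y z : Site d} (h : Near L x y) (h' : Near M y z) :
    Near (L + M) x z :=
  fun i => (abs_sub_le _ (y i) _).trans_lt (add_lt_add (h i) (h' i))

theorem Near.mono {d : ℕ} {L M : ℤ} {x y : Site d} (h : Near L x y) (hLM : L ≤ M) : Near M x y :=
  fun i => (h i).trans_le hLM

theorem near_add_right {d : ℕ} {L : ℤ} {x y z : Site d} : Near L (x + z) (y + z) ↔ Near L x y := by
  simp [Near]

/-- The sites at sup-distance less than `L` from `x`. -/
noncomputable def nearBox {d : ℕ} (L : ℤ) (x : Site d) : Finset (Site d) :=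
  Fintype.piFinset fun i => Finset.Ioo (x i - L) (x i + L)

theorem mem_nearBox {d : ℕ} {L : ℤ} {x y : Site d} : y ∈ nearBox L x ↔ Near L y x := by
  simp only [nearBox, Fintype.mem_piFinset, Finset.mem_Ioo, Near, abs_lt]
  exact forall_congr' fun i => by constructor <;> intro h <;> constructor <;> linarith

theorem card_nearBox {d : ℕ} (L : ℤ) (x : Site d) :
    (nearBox L x).card = (2 * L - 1).toNat ^ d := by
  simp [nearBox]
  congr 1
  omega

/-- The configuration seen from `x` agrees on `p.1` with the indicator of `p.2`. -/
def HasPattern {d : ℕ} (γ : Config d) (p : Finset (Site d) × Finset (Site d)) (x : Site d) : Prop :=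
  ∀ u ∈ p.1, (γ (x + u) = true ↔ u ∈ p.2)

/-- The pattern `p` is seen from `x`, and from no other site near `x`. -/
def IsolatedPattern {d : ℕ} (L : ℤ) (γ : Config d) (p : Finset (Site d) × Finset (Site d))
    (x : Site d) : Prop :=
  HasPattern γ p x ∧ ∀ y, Near L y x → y ≠ x → ¬HasPattern γ p y

/-- Greedy construction of a separated set along a sequence of patterns. -/
def greedySet {d : ℕ} (L : ℤ) (e : ℕ → Finset (Site d) × Finset (Site d)) (γ : Config d) :
    ℕ → Site d → Prop
  | 0 => fun _ => False
  | n + 1 => fun x => greedySet L e γ n x ∨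
      (IsolatedPattern L γ (e n) x ∧ ∀ y, Near L y x → ¬greedySet L e γ n y)

theorem greedySet_mono {d : ℕ} {L : ℤ} {e : ℕ → Finset (Site d) × Finset (Site d)} {γ : Config d}
    {m n : ℕ} (hmn : m ≤ n) {x : Site d} (h : greedySet L e γ m x) : greedySet L e γ n x := by
  induction n, hmn using Nat.le_induction with
  | base => exact h
  | succ n _ ih => exact Or.inl ih

/-- Sites added at different stages are kept apart by the greedy condition. Sites added at the same
stage share a pattern, and isolation forbids that for two near sites. -/
theorem greedySet_separated {d : ℕ} {L : ℤ} {e : ℕ → Finset (Site d) × Finset (Site d)}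
    {γ : Config d} (n : ℕ) {x y : Site d} (hx : greedySet L e γ n x) (hy : greedySet L e γ n y)
    (h : Near L x y) : x = y := by
  induction n with
  | zero => exact hx.elim
  | succ n ih =>
    rcases hx with hx | hx <;> rcases hy with hy | hy
    · exact ih hx hy
    · exact absurd hx (hy.2 x h)
    · exact absurd hy (hx.2 y h.symm)
    · by_contra hne
      exact hy.1.2 x h hne hx.1.1

/-- By aperiodicity each of the finitely many sites `y ≠ x` near `x` sees a different coin from `x`
at some offset `u y`. The pattern seen from `x` on these offsets excludes them all. -/
theorem exists_isolatedPattern {d : ℕ} (L : ℤ) {γ : Config d} (hγ : Aperiodic γ) (x : Site d) :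
    ∃ p, IsolatedPattern L γ p x := by
  have h : ∀ y, ∃ u, y ≠ x → γ (y + u) ≠ γ (x + u) := by
    intro y
    by_cases hy : y = x
    · exact ⟨0, fun h => absurd hy h⟩
    · obtain ⟨u, hu⟩ := hγ (x - y) (sub_ne_zero.2 (Ne.symm hy))
      refine ⟨u - x, fun _ => ?_⟩
      rwa [add_sub_cancel, show y + (u - x) = u - (x - y) by abel]
  choose u hu using h
  classical
  refine ⟨((nearBox L x).image u, ((nearBox L x).image u).filter fun v => γ (x + v) = true), ?_, ?_⟩
  · intro v hv
    simp only [Finset.mem_filter, hv, true_and]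
  · intro y hy hne hp
    have hm : u y ∈ (nearBox L x).image u := Finset.mem_image_of_mem _ (mem_nearBox.2 hy)
    have := hp (u y) hm
    simp only [Finset.mem_filter, hm, true_and] at this
    exact hu y hne (Bool.eq_iff_iff.2 this)

theorem greedySet_maximal {d : ℕ} {L : ℤ} (hL : 0 < L)
    {e : ℕ → Finset (Site d) × Finset (Site d)} (he : Function.Surjective e) {γ : Config d}
    (hγ : Aperiodic γ) (x : Site d) : ∃ s, Near L x s ∧ ∃ n, greedySet L e γ n s := by
  obtain ⟨p, hp⟩ := exists_isolatedPattern L hγ x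
  obtain ⟨n, rfl⟩ := he p
  by_cases h : ∃ y, Near L y x ∧ greedySet L e γ n y
  · obtain ⟨y, hy, hn⟩ := h
    exact ⟨y, hy.symm, n, hn⟩
  · push Not at h
    exact ⟨x, near_self hL x, n + 1, Or.inr ⟨hp, h⟩⟩

theorem shiftConfig_add {d : ℕ} (z : Site d) (γ : Config d) (x : Site d) :
    shiftConfig z γ (x + z) = γ x := by
  simp [shiftConfig]

theorem hasPattern_shift {d : ℕ} (z : Site d) (γ : Config d)
    (p : Finset (Site d) × Finset (Site d)) (x : Site d) :
    HasPattern (shiftConfig z γ) p (x + z) ↔ HasPattern γ p x := by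
  have : ∀ u, shiftConfig z γ (x + z + u) = γ (x + u) := fun u => by
    rw [show x + z + u = x + u + z by abel, shiftConfig_add]
  simp only [HasPattern, this]

theorem isolatedPattern_shift {d : ℕ} (L : ℤ) (z : Site d) (γ : Config d)
    (p : Finset (Site d) × Finset (Site d)) (x : Site d) :
    IsolatedPattern L (shiftConfig z γ) p (x + z) ↔ IsolatedPattern L γ p x := by
  refine and_congr (hasPattern_shift z γ p x) ((Equiv.addRight z).forall_congr ?_).symm
  intro y
  simp [near_add_right, hasPattern_shift]

theorem greedySet_shift {d : ℕ} (L : ℤ) (e : ℕ → Finset (Site d) × Finset (Site d)) (z : Site d)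
    (γ : Config d) (n : ℕ) (x : Site d) :
    greedySet L e (shiftConfig z γ) n (x + z) ↔ greedySet L e γ n x := by
  induction n generalizing x with
  | zero => rfl
  | succ n ih =>
    refine or_congr (ih x) (and_congr (isolatedPattern_shift L z γ _ x)
      ((Equiv.addRight z).forall_congr ?_).symm)
    intro y
    simp [near_add_right, ih]

theorem measurable_eval_eq {d : ℕ} (x : Site d) (b : Bool) :
    Measurable fun γ : Config d => γ x = b :=
  (measurable_of_countable fun a : Bool => a = b).comp (measurable_pi_apply x)

theorem measurable_hasPattern {d : ℕ} (p : Finset (Site d) × Finset (Site d)) (x : Site d) :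
    Measurable fun γ : Config d => HasPattern γ p x :=
  Measurable.forall fun _ => Measurable.forall fun _ =>
    (measurable_eval_eq _ _).iff measurable_const

theorem measurable_isolatedPattern {d : ℕ} (L : ℤ) (p : Finset (Site d) × Finset (Site d))
    (x : Site d) : Measurable fun γ : Config d => IsolatedPattern L γ p x :=
  (measurable_hasPattern p x).and <| Measurable.forall fun y => Measurable.forall fun _ =>
    Measurable.forall fun _ => (measurable_hasPattern p y).not

theorem measurable_greedySet {d : ℕ} (L : ℤ) (e : ℕ → Finset (Site d) × Finset (Site d)) (n : ℕ)
    (x : Site d) : Measurable fun γ : Config d => greedySet L e γ n x := by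
  induction n generalizing x with
  | zero => exact measurable_const
  | succ n ih =>
    exact (ih x).or ((measurable_isolatedPattern L _ x).and
      (Measurable.forall fun y => Measurable.forall fun _ => (ih y).not))

/-- `s` is the lexicographically least point of `S` near `x`. -/
def IsCenter {d : ℕ} (L : ℤ) (S : Site d → Prop) (x s : Site d) : Prop :=
  S s ∧ Near L x s ∧ ∀ t, S t → Near L x t → toLex s ≤ toLex t

theorem IsCenter.unique {d : ℕ} {L : ℤ} {S : Site d → Prop} {x s t : Site d}
    (hs : IsCenter L S x s) (ht : IsCenter L S x t) : s = t :=
  toLex.injective (le_antisymm (hs.2.2 t ht.1 ht.2.1) (ht.2.2 s hs.1 hs.2.1))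

theorem exists_isCenter {d : ℕ} {L : ℤ} {S : Site d → Prop} {x s : Site d} (hs : S s)
    (h : Near L x s) : ∃ t, IsCenter L S x t := by
  classical
  obtain ⟨t, ht, hmin⟩ := ((nearBox L x).filter S).exists_min_image toLex
    ⟨s, Finset.mem_filter.2 ⟨mem_nearBox.2 h.symm, hs⟩⟩
  rw [Finset.mem_filter, mem_nearBox] at ht
  exact ⟨t, ht.2, ht.1.symm, fun u hu hxu =>
    hmin u (Finset.mem_filter.2 ⟨mem_nearBox.2 hxu.symm, hu⟩)⟩

theorem isCenter_add_right {d : ℕ} {L : ℤ} {S S' : Site d → Prop} {z : Site d}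
    (hS : ∀ x, S' (x + z) ↔ S x) (x s : Site d) :
    IsCenter L S' (x + z) (s + z) ↔ IsCenter L S x s := by
  refine and_congr (hS s) (and_congr near_add_right ((Equiv.addRight z).forall_congr ?_).symm)
  intro t
  simp [near_add_right, hS, toLex_add]

/-- `c` sends each site to the lexicographically least nearby point of a separated set. -/
def IsBoxClustering {d : ℕ} (L : ℤ) (c : Site d → Site d) : Prop :=
  ∃ S : Site d → Prop, (∀ s t, S s → S t → Near L s t → s = t) ∧
    ∀ x s, c x = s ↔ IsCenter L S x s

/-- An equivariant measurable clustering at scale `L`. -/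
theorem exists_boxClustering (d : ℕ) {L : ℤ} (hL : 0 < L) :
    ∃ c : Config d → Site d → Site d, (∀ x, Measurable fun γ => c γ x) ∧
      (∀ z γ x, c (shiftConfig z γ) (x + z) = c γ x + z) ∧
      ∀ γ, Aperiodic γ → IsBoxClustering L (c γ) := by
  classical
  obtain ⟨e, he⟩ := exists_surjective_nat (Finset (Site d) × Finset (Site d))
  let S : Config d → Site d → Prop := fun γ x => ∃ n, greedySet L e γ n x
  have hS : ∀ z γ x, S (shiftConfig z γ) (x + z) ↔ S γ x := fun z γ x =>
    exists_congr fun n => greedySet_shift L e z γ n x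
  let c : Config d → Site d → Site d := fun γ x =>
    -- The default `x` is itself equivariant, so equivariance holds for every configuration and not
    -- just for the aperiodic ones.
    if h : ∃ s, IsCenter L (S γ) x s then h.choose else x
  have hc : ∀ γ x s, IsCenter L (S γ) x s → c γ x = s := by
    intro γ x s h
    have h' : ∃ s, IsCenter L (S γ) x s := ⟨s, h⟩
    simp only [c, dif_pos h']
    exact h'.choose_spec.unique h
  have hc' : ∀ γ x, (¬∃ s, IsCenter L (S γ) x s) → c γ x = x := fun γ x h => dif_neg h
  refine ⟨c, ?_, ?_, ?_⟩
  · intro x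
    have hmS : ∀ y, Measurable fun γ => S γ y := fun y =>
      Measurable.exists fun n => measurable_greedySet L e n y
    have hmC : ∀ s, Measurable fun γ => IsCenter L (S γ) x s := fun s =>
      (hmS s).and (measurable_const.and (Measurable.forall fun t =>
        (hmS t).imp measurable_const))
    refine measurable_to_countable' fun s => ?_
    have : (fun γ => c γ x) ⁻¹' {s} =
        {γ | IsCenter L (S γ) x s ∨ (s = x ∧ ¬∃ t, IsCenter L (S γ) x t)} := by
      ext γ
      change c γ x = s ↔ (IsCenter L (S γ) x s ∨ (s = x ∧ ¬∃ t, IsCenter L (S γ) x t))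
      by_cases h : ∃ t, IsCenter L (S γ) x t
      · obtain ⟨t, ht⟩ := h
        constructor
        · rintro rfl
          rw [hc γ x t ht]
          exact Or.inl ht
        · rintro (h | h)
          · exact hc γ x s h
          · exact absurd ⟨t, ht⟩ h.2
      · rw [hc' γ x h]
        constructor
        · rintro rfl
          exact Or.inr ⟨rfl, h⟩
        · rintro (h' | h')
          · exact absurd ⟨s, h'⟩ h
          · exact h'.1.symm
    rw [this]
    exact measurableSet_setOfPred.2 ((hmC s).or (measurable_const.and (Measurable.exists hmC).not))
  · intro z γ x
    by_cases h : ∃ t, IsCenter L (S γ) x t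
    · obtain ⟨t, ht⟩ := h
      rw [hc γ x t ht]
      exact hc _ _ _ ((isCenter_add_right (hS z γ) x t).2 ht)
    · rw [hc' γ x h]
      refine hc' _ _ fun ⟨t, ht⟩ => h ⟨t - z, ?_⟩
      rw [← isCenter_add_right (hS z γ), sub_add_cancel]
      exact ht
  · intro γ hγ
    refine ⟨S γ, ?_, ?_⟩
    · rintro s t ⟨m, hm⟩ ⟨n, hn⟩ h
      exact greedySet_separated (max m n) (greedySet_mono (le_max_left _ _) hm)
        (greedySet_mono (le_max_right _ _) hn) h
    · intro x s
      obtain ⟨t, hxt, ht⟩ := greedySet_maximal hL he hγ x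
      obtain ⟨u, hu⟩ := exists_isCenter (S := S γ) ht hxt
      constructor
      · rintro rfl
        rw [hc γ x u hu]
        exact hu
      · exact hc γ x s

/-! ### Packing bounds and the cells cut by a boundary -/

/-- A separated finite set in a box with sides `n i * l` has at most `∏ i, n i` points. -/
theorem card_le_prod_of_separated {d : ℕ} {l : ℤ} (hl : 0 < l) (T : Finset (Site d))
    (hT : ∀ s ∈ T, ∀ t ∈ T, Near l s t → s = t) (lo : Site d) (n : Fin d → ℕ)
    (hlo : ∀ t ∈ T, ∀ i, lo i ≤ t i ∧ t i < lo i + n i * l) : T.card ≤ ∏ i, n i := by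
  -- Rounding down to the grid of mesh `l` is injective on a separated set.
  have h := Finset.card_le_card_of_injOn (s := T)
    (t := Fintype.piFinset fun i => Finset.Ico (0 : ℤ) (n i)) (fun t i => (t i - lo i) / l) ?_ ?_
  · simpa using h
  · intro t ht
    rw [Finset.mem_coe, Fintype.mem_piFinset]
    intro i
    have := hlo t ht i
    rw [Finset.mem_Ico]
    constructor
    · exact Int.ediv_nonneg (by linarith) hl.le
    · exact Int.ediv_lt_of_lt_mul hl (by linarith)
  · intro s hs t ht hst
    refine hT s hs t ht fun i => ?_
    have hi : (s i - lo i) / l = (t i - lo i) / l := congrFun hst i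
    have h1 := Int.emod_add_mul_ediv (s i - lo i) l
    have h2 := Int.emod_add_mul_ediv (t i - lo i) l
    have h3 := Int.emod_nonneg (s i - lo i) hl.ne'
    have h4 := Int.emod_nonneg (t i - lo i) hl.ne'
    have h5 := Int.emod_lt_of_pos (s i - lo i) hl
    have h6 := Int.emod_lt_of_pos (t i - lo i) hl
    rw [hi] at h1
    rw [abs_lt]
    constructor <;> linarith

/-- Each cell of a box clustering is a box minus at most `4 ^ d` boxes. -/
theorem exists_cell_shape {d : ℕ} {L : ℤ} (hL : 0 < L) {c : Site d → Site d}
    (hc : IsBoxClustering L c) {s : Site d} (hs : ∃ y, c y = s) :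
    ∃ T : Finset (Site d), T.card ≤ 4 ^ d ∧ (∀ t ∈ T, Near (2 * L) t s) ∧
      ∀ y, c y = s ↔ Near L y s ∧ ∀ t ∈ T, ¬Near L y t := by
  classical
  obtain ⟨S, hsep, hS⟩ := hc
  have hsS : S s := by
    obtain ⟨y, hy⟩ := hs
    exact ((hS y s).1 hy).1
  -- Only lexicographically smaller centres can take sites from the box around `s`, and only if
  -- within `2 * L` of `s`. The separated centres lie in a box of side `4 * L`, whence `4 ^ d`.
  refine ⟨(nearBox (2 * L) s).filter fun t => S t ∧ toLex t < toLex s, ?_, ?_, ?_⟩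
  · have := card_le_prod_of_separated hL
      ((nearBox (2 * L) s).filter fun t => S t ∧ toLex t < toLex s)
      (fun t ht u hu h => hsep t u (Finset.mem_filter.1 ht).2.1 (Finset.mem_filter.1 hu).2.1 h)
      (fun i => s i - 2 * L) (fun _ => 4) ?_
    · simpa using this
    · intro t ht i
      have := abs_lt.1 (mem_nearBox.1 (Finset.mem_filter.1 ht).1 i)
      push_cast
      constructor <;> linarith
  · intro t ht
    exact mem_nearBox.1 (Finset.mem_filter.1 ht).1
  · intro y
    rw [hS]
    constructor
    · rintro ⟨-, h, hmin⟩
      refine ⟨h, fun t ht hyt => ?_⟩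
      rw [Finset.mem_filter] at ht
      exact (hmin t ht.2.1 hyt).not_gt ht.2.2
    · rintro ⟨h, hT⟩
      refine ⟨hsS, h, fun t ht hyt => ?_⟩
      by_contra hlt
      refine hT t (Finset.mem_filter.2 ⟨mem_nearBox.2 ?_, ht, not_le.1 hlt⟩) hyt
      have := hyt.symm.trans h
      rwa [← two_mul] at this

/-- Sites whose `2 * l`-neighbourhood meets the boundary of a box, near a face. -/
def NearFace {d : ℕ} (l L : ℤ) (b : Site d) (i : Fin d) (ε : Bool) (t : Site d) : Prop :=
  Near (L + 2 * l) t b ∧ if ε = true then L - 2 * l < t i - b i else L - 2 * l < b i - t i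

theorem exists_nearFace {d : ℕ} {l L : ℤ} (hl : 0 < l) {b y t : Site d} (hyt : Near (2 * l) y t)
    (h : ¬(Near L t b ↔ Near L y b)) : ∃ i ε, NearFace l L b i ε t := by
  have key : ∀ i, L - 2 * l < |t i - b i| → Near (L + 2 * l) t b → ∃ i ε, NearFace l L b i ε t := by
    intro i hi hn
    rcases lt_abs.1 hi with h | h
    · exact ⟨i, true, hn, by simpa using h⟩
    · exact ⟨i, false, hn, by simpa using h⟩
  by_cases ht : Near L t b
  · have hy : ¬Near L y b := fun hy => h ⟨fun _ => hy, fun _ => ht⟩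
    unfold Near at hy
    push Not at hy
    obtain ⟨i, hi⟩ := hy
    refine key i ?_ (ht.mono (by linarith))
    have h1 := hyt i
    have h2 := abs_sub_le (y i) (t i) (b i)
    linarith
  · have hy : Near L y b := by
      by_contra hy
      exact h ⟨fun h => absurd h ht, fun h => absurd h hy⟩
    have hn : Near (L + 2 * l) t b := (hyt.symm.trans hy).mono (by linarith)
    unfold Near at ht
    push Not at ht
    obtain ⟨i, hi⟩ := ht
    exact key i (by linarith) hn

/-- The sites near one face fill a slab of thickness `4 * l` and width `(2 * K + 4) * l` in the
other directions, so this is a surface count in `K`. -/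
theorem card_nearFace_le {d : ℕ} {l : ℤ} (hl : 0 < l) (K : ℕ) (T : Finset (Site d))
    (hT : ∀ s ∈ T, ∀ t ∈ T, Near l s t → s = t) (b : Site d) (i : Fin d) (ε : Bool)
    (h : ∀ t ∈ T, NearFace l (K * l) b i ε t) : T.card ≤ 4 * (2 * K + 4) ^ (d - 1) := by
  have := card_le_prod_of_separated hl T hT
    (Function.update (fun j => b j - (K * l + 2 * l)) i
      (if ε = true then b i + (K * l - 2 * l) else b i - (K * l + 2 * l)))
    (Function.update (fun _ => 2 * K + 4) i 4) ?_
  · rw [Finset.prod_update_of_mem (Finset.mem_univ i)] at this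
    simpa [Finset.card_sdiff] using this
  · intro t ht j
    obtain ⟨h1, h2⟩ := h t ht
    have hj := abs_lt.1 (h1 j)
    by_cases hji : j = i
    · subst hji
      simp only [Function.update_self]
      push_cast
      cases ε
      · simp only [Bool.false_eq_true, if_false] at h2 ⊢
        constructor <;> linarith
      · simp only [if_true] at h2 ⊢
        constructor <;> linarith
    · simp only [Function.update_of_ne hji]
      push_cast
      constructor <;> linarith

/-- The number of small cells that a big cell can cut. -/
def straddlingBound (d K : ℕ) : ℕ := (4 ^ d + 1) * (d * 2) * (4 * (2 * K + 4) ^ (d - 1))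

/-- Whether a site lies in the big cell depends only on its membership in at most `4 ^ d + 1` boxes.
A site whose `2 * l`-neighbourhood meets both the cell and its complement is therefore near one of
the `2 * d` faces of one of these boxes. -/
theorem card_straddling_le {d : ℕ} {l : ℤ} (hl : 0 < l) {K : ℕ} (hK : 0 < K) {c : Site d → Site d}
    (hc : IsBoxClustering (K * l) c) (s : Site d) (T : Finset (Site d))
    (hT : ∀ s ∈ T, ∀ t ∈ T, Near l s t → s = t)
    (h : ∀ t ∈ T, ∃ y, Near (2 * l) y t ∧ ¬(c t = s ↔ c y = s)) :
    T.card ≤ straddlingBound d K := by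
  classical
  by_cases hs : ∃ y, c y = s
  swap
  · have : T = ∅ := by
      refine Finset.eq_empty_of_forall_notMem fun t ht => ?_
      obtain ⟨y, -, hy⟩ := h t ht
      exact hy ⟨fun h => absurd ⟨t, h⟩ hs, fun h => absurd ⟨y, h⟩ hs⟩
    simp [this]
  have hKl : (0 : ℤ) < K * l := by positivity
  obtain ⟨U, hU, -, hcs⟩ := exists_cell_shape hKl hc hs
  have hcover : T ⊆ ((insert s U) ×ˢ (Finset.univ : Finset (Fin d × Bool))).biUnion
      fun p => T.filter fun t => NearFace l (K * l) p.1 p.2.1 p.2.2 t := by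
    intro t ht
    obtain ⟨y, hyt, hy⟩ := h t ht
    have : ∃ b ∈ insert s U, ¬(Near (K * l) t b ↔ Near (K * l) y b) := by
      by_contra hcon
      push Not at hcon
      refine hy ?_
      rw [hcs, hcs, hcon s (Finset.mem_insert_self _ _)]
      refine and_congr_right fun _ => forall_congr' fun b => forall_congr' fun hb => ?_
      rw [hcon b (Finset.mem_insert_of_mem hb)]
    obtain ⟨b, hb, hbt⟩ := this
    obtain ⟨i, ε, hf⟩ := exists_nearFace hl hyt hbt
    exact Finset.mem_biUnion.2 ⟨(b, i, ε), Finset.mem_product.2 ⟨hb, Finset.mem_univ _⟩,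
      Finset.mem_filter.2 ⟨ht, hf⟩⟩
  calc T.card ≤ _ := Finset.card_le_card hcover
    _ ≤ _ := Finset.card_biUnion_le_card_mul _ _ (4 * (2 * K + 4) ^ (d - 1)) fun p _ =>
      card_nearFace_le hl K _ (fun t ht u hu => hT t (Finset.mem_filter.1 ht).1 u
        (Finset.mem_filter.1 hu).1) p.1 p.2.1 p.2.2 fun t ht => (Finset.mem_filter.1 ht).2
    _ ≤ _ := by
      unfold straddlingBound
      gcongr
      rw [Finset.card_product]
      simp only [Finset.card_univ, Fintype.card_prod, Fintype.card_fin, Fintype.card_bool]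
      gcongr
      exact (Finset.card_insert_le _ _).trans (by omega)

/-! ### Nested cells and the one-step comparison -/

/-- Composition of clusterings, producing nested cells. -/
def coarse {d : ℕ} (c : ℕ → Site d → Site d) : ℕ → Site d → Site d
  | 0 => id
  | k + 1 => fun x => c (k + 1) (coarse c k x)

/-- The displacements form a geometric series: `2 * K ^ k + K ^ (k + 1) ≤ 2 * K ^ (k + 1)` because
`K ≥ 2`. -/
theorem near_coarse {d : ℕ} {K : ℕ} (hK : 2 ≤ K) {c : ℕ → Site d → Site d}
    (hc : ∀ k, IsBoxClustering ((K : ℤ) ^ k) (c k)) (k : ℕ) (x : Site d) :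
    Near (2 * (K : ℤ) ^ k) x (coarse c k x) := by
  induction k with
  | zero => exact near_self (by norm_num) x
  | succ k ih =>
    obtain ⟨S, -, hS⟩ := hc (k + 1)
    have h := ((hS (coarse c k x) _).1 rfl).2.1
    refine (ih.trans h).mono ?_
    have hp : (0 : ℤ) < (K : ℤ) ^ k := by positivity
    have h2 : (2 : ℤ) ≤ K := by exact_mod_cast hK
    rw [pow_succ]
    nlinarith

theorem coarse_separated {d : ℕ} {K : ℕ} {c : ℕ → Site d → Site d}
    (hc : ∀ k, IsBoxClustering ((K : ℤ) ^ k) (c k)) (k : ℕ) (x y : Site d)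
    (h : Near ((K : ℤ) ^ k) (coarse c k x) (coarse c k y)) : coarse c k x = coarse c k y := by
  cases k with
  | zero =>
    funext i
    have := h i
    rw [pow_zero, Int.abs_lt_one_iff] at this
    linarith
  | succ k =>
    obtain ⟨S, hsep, hS⟩ := hc (k + 1)
    exact hsep _ _ ((hS (coarse c k x) _).1 rfl).1 ((hS (coarse c k y) _).1 rfl).1 h

open Classical in
/-- One-step comparison of a union of small cells with a big cell. -/
theorem abs_disc_union_le {d : ℕ} (γ : Config d) (a c : Site d → Site d) (A : Finset (Site d))
    (s : Site d) {F : ℝ} {N : ℕ}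
    (hT : ((A.filter fun y => ¬(c (a y) = s ↔ c y = s)).image a).card ≤ N)
    (h1 : ∀ t, |disc γ (A.filter fun y => a y = t)| ≤ F)
    (h2 : ∀ t, |disc γ ((A.filter fun y => c y = s).filter fun y => a y = t)| ≤ F) :
    |disc γ (A.filter fun y => c (a y) = s)| ≤
      |disc γ (A.filter fun y => c y = s)| + N * (2 * F) := by
  set T := (A.filter fun y => ¬(c (a y) = s ↔ c y = s)).image a with hTdef
  have hF : 0 ≤ F := (abs_nonneg _).trans (h1 s)
  -- A small cell that is not cut contributes equally to both unions. Each cut cell `t` is replaced,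
  -- whole or not at all, for its part inside the big cell.
  have key : disc γ (A.filter fun y => c (a y) = s) = disc γ (A.filter fun y => c y = s) +
      ∑ t ∈ T, ((if c t = s then 1 else 0) * disc γ (A.filter fun y => a y = t) -
        disc γ ((A.filter fun y => c y = s).filter fun y => a y = t)) := by
    rw [← sub_eq_iff_eq_add']
    have e1 : disc γ (A.filter fun y => c (a y) = s) - disc γ (A.filter fun y => c y = s) =
        ∑ y ∈ A, ((if c (a y) = s then 1 else 0) * spin γ y -
          (if c y = s then 1 else 0) * spin γ y) := by
      simp [disc, Finset.sum_filter, Finset.sum_sub_distrib]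
    have e2 : ∑ y ∈ A, ((if c (a y) = s then 1 else 0) * spin γ y -
          (if c y = s then 1 else 0) * spin γ y) =
        ∑ y ∈ A.filter (fun y => a y ∈ T), ((if c (a y) = s then 1 else 0) * spin γ y -
          (if c y = s then 1 else 0) * spin γ y) := by
      refine (Finset.sum_subset (Finset.filter_subset _ _) fun y hy hn => ?_).symm
      have : c (a y) = s ↔ c y = s := by
        by_contra hcon
        exact hn (Finset.mem_filter.2 ⟨hy, Finset.mem_image_of_mem _
          (Finset.mem_filter.2 ⟨hy, hcon⟩)⟩)
      simp [this]
    rw [e1, e2, ← Finset.sum_fiberwise_of_maps_to (g := a) (t := T)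
      fun y hy => (Finset.mem_filter.1 hy).2]
    refine Finset.sum_congr rfl fun t ht => ?_
    have e3 : (A.filter fun y => a y ∈ T).filter (fun y => a y = t) =
        A.filter fun y => a y = t := by
      ext y
      simp only [Finset.mem_filter]
      constructor
      · rintro ⟨⟨h, -⟩, h'⟩
        exact ⟨h, h'⟩
      · rintro ⟨h, rfl⟩
        exact ⟨⟨h, ht⟩, rfl⟩
    rw [e3, Finset.sum_sub_distrib]
    congr 1
    · rw [disc, Finset.mul_sum]
      refine Finset.sum_congr rfl fun y hy => ?_
      rw [(Finset.mem_filter.1 hy).2]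
    · rw [disc, Finset.filter_filter, Finset.sum_filter, Finset.sum_filter]
      refine Finset.sum_congr rfl fun y _ => ?_
      by_cases hy : c y = s <;> by_cases hy' : a y = t <;> simp [hy, hy']
  rw [key]
  refine (abs_add_le _ _).trans (by
    gcongr
    refine (Finset.abs_sum_le_sum_abs _ _).trans ?_
    refine (Finset.sum_le_card_nsmul _ _ (2 * F) fun t _ => ?_).trans ?_
    · refine (abs_sub _ _).trans ?_
      have : |(if c t = s then (1 : ℝ) else 0) * disc γ (A.filter fun y => a y = t)| ≤ F := by
        split_ifs
        · simpa using h1 t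
        · simpa using hF
      linarith [h2 t]
    · rw [nsmul_eq_mul]
      gcongr)

/-! ### Test sets and the discrepancy of nested cells -/

open Classical in
/-- Sets obtained from `A` by at most `m` intersections with, or removals of, members of `B`. -/
noncomputable def cutFamily {d : ℕ} (B : Finset (Finset (Site d))) (A : Finset (Site d)) :
    ℕ → Finset (Finset (Site d))
  | 0 => {A}
  | m + 1 => cutFamily B A m ∪ (Finset.image₂ (· ∩ ·) (cutFamily B A m) B ∪
      Finset.image₂ (· \ ·) (cutFamily B A m) B)

theorem card_cutFamily_le {d : ℕ} (B : Finset (Finset (Site d))) (A : Finset (Site d)) (m : ℕ) :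
    (cutFamily B A m).card ≤ (1 + 2 * B.card) ^ m := by
  classical
  induction m with
  | zero => simp [cutFamily]
  | succ m ih =>
    rw [cutFamily]
    refine (Finset.card_union_le _ _).trans ?_
    have h := Finset.card_union_le (Finset.image₂ (· ∩ ·) (cutFamily B A m) B)
      (Finset.image₂ (· \ ·) (cutFamily B A m) B)
    have h1 := Finset.card_image₂_le (· ∩ ·) (cutFamily B A m) B
    have h2 := Finset.card_image₂_le (· \ ·) (cutFamily B A m) B
    calc _ ≤ (cutFamily B A m).card * (1 + 2 * B.card) := by linarith
      _ ≤ _ := by rw [pow_succ]; gcongr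

theorem cutFamily_mono {d : ℕ} {B : Finset (Finset (Site d))} {A : Finset (Site d)} {m n : ℕ}
    (h : m ≤ n) : cutFamily B A m ⊆ cutFamily B A n := by
  induction n, h using Nat.le_induction with
  | base => exact subset_rfl
  | succ n _ ih =>
    rw [cutFamily]
    exact ih.trans Finset.subset_union_left

theorem subset_of_mem_cutFamily {d : ℕ} {B : Finset (Finset (Site d))} {A A' : Finset (Site d)}
    {m : ℕ} (h : A' ∈ cutFamily B A m) : A' ⊆ A := by
  classical
  induction m generalizing A' with
  | zero => rw [cutFamily, Finset.mem_singleton] at h; exact h.subset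
  | succ m ih =>
    rw [cutFamily, Finset.mem_union, Finset.mem_union, Finset.mem_image₂, Finset.mem_image₂] at h
    rcases h with h | ⟨X, hX, Y, -, rfl⟩ | ⟨X, hX, Y, -, rfl⟩
    · exact ih h
    · exact Finset.inter_subset_left.trans (ih hX)
    · exact Finset.sdiff_subset.trans (ih hX)

open Classical in
theorem inter_mem_cutFamily {d : ℕ} {B : Finset (Finset (Site d))} {A X Y : Finset (Site d)}
    {m : ℕ} (hX : X ∈ cutFamily B A m) (hY : Y ∈ B) : X ∩ Y ∈ cutFamily B A (m + 1) := by
  rw [cutFamily, Finset.mem_union, Finset.mem_union]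
  exact Or.inr (Or.inl (Finset.mem_image₂_of_mem hX hY))

open Classical in
theorem sdiff_mem_cutFamily {d : ℕ} {B : Finset (Finset (Site d))} {A X Y : Finset (Site d)}
    {m : ℕ} (hX : X ∈ cutFamily B A m) (hY : Y ∈ B) : X \ Y ∈ cutFamily B A (m + 1) := by
  rw [cutFamily, Finset.mem_union, Finset.mem_union]
  exact Or.inr (Or.inr (Finset.mem_image₂_of_mem hX hY))

open Classical in
theorem sdiff_biUnion_mem_cutFamily {d : ℕ} {B : Finset (Finset (Site d))} {A X : Finset (Site d)}
    {m : ℕ} (hX : X ∈ cutFamily B A m) (f : Site d → Finset (Site d)) (T : Finset (Site d))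
    (hT : ∀ t ∈ T, f t ∈ B) : X \ T.biUnion f ∈ cutFamily B A (m + T.card) := by
  induction T using Finset.induction_on with
  | empty => simpa using hX
  | insert t T ht ih =>
    have hX' : X \ (insert t T).biUnion f = (X \ T.biUnion f) \ f t := by
      rw [Finset.biUnion_insert]
      ext
      simp only [Finset.mem_sdiff, Finset.mem_union]
      tauto
    rw [hX', Finset.card_insert_of_notMem ht, ← add_assoc]
    exact sdiff_mem_cutFamily (ih fun u hu => hT u (Finset.mem_insert_of_mem hu))
      (hT t (Finset.mem_insert_self _ _))

open Classical in
/-- The boxes at scales up to `K ^ k` with centres in a large box. -/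
noncomputable def cutBoxes (d K k : ℕ) : Finset (Finset (Site d)) :=
  (Finset.range (k + 1) ×ˢ nearBox (10 * (K : ℤ) ^ k) 0).image fun p => nearBox ((K : ℤ) ^ p.1) p.2

/-- The sets whose discrepancies control the cells near the origin up to level `k`. -/
noncomputable def testSets (d K k m : ℕ) : Finset (Finset (Site d)) :=
  cutFamily (cutBoxes d K k) (nearBox (6 * (K : ℤ) ^ k) 0) m

theorem nearBox_mem_cutBoxes {d K k j : ℕ} (hj : j ≤ k) {b : Site d}
    (hb : Near (10 * (K : ℤ) ^ k) b 0) : nearBox ((K : ℤ) ^ j) b ∈ cutBoxes d K k := by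
  classical
  exact Finset.mem_image.2 ⟨(j, b), Finset.mem_product.2
    ⟨Finset.mem_range.2 (by omega), mem_nearBox.2 hb⟩, rfl⟩

-- Restricting to a box cell costs one intersection and at most `4 ^ d` removals. The radii fit
-- together: test sets lie within `6 * K ^ k` of the origin, centres of cells meeting them within `8
-- * K ^ k`, and removed boxes have centres within `10 * K ^ k`.
open Classical in
theorem filter_mem_testSets {d K k j m : ℕ} (hK : 0 < K) (hj : j ≤ k) {c : Site d → Site d}
    (hc : IsBoxClustering ((K : ℤ) ^ j) c) {A : Finset (Site d)} (hA : A ∈ testSets d K k m)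
    {s : Site d} (hs : Near (8 * (K : ℤ) ^ k) s 0) (hs' : ∃ y, c y = s) :
    A.filter (fun y => c y = s) ∈ testSets d K k (m + (4 ^ d + 1)) ∧
      ((A.filter fun y => c y = s).card : ℝ) ≤ (2 * (K : ℝ) ^ j) ^ d := by
  have hL : (0 : ℤ) < (K : ℤ) ^ j := by positivity
  have hLk : (K : ℤ) ^ j ≤ (K : ℤ) ^ k := pow_le_pow_right₀ (by exact_mod_cast hK) hj
  obtain ⟨T, hT, hTs, hshape⟩ := exists_cell_shape hL hc hs'
  have hset : A.filter (fun y => c y = s) =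
      (A ∩ nearBox ((K : ℤ) ^ j) s) \ T.biUnion fun t => nearBox ((K : ℤ) ^ j) t := by
    ext y
    simp only [Finset.mem_filter, hshape, Finset.mem_sdiff, Finset.mem_inter, mem_nearBox,
      Finset.mem_biUnion, not_exists, not_and, and_assoc]
  constructor
  · rw [hset]
    have h1 : A ∩ nearBox ((K : ℤ) ^ j) s ∈ testSets d K k (m + 1) :=
      inter_mem_cutFamily hA (nearBox_mem_cutBoxes hj (hs.mono (by linarith)))
    have h2 := sdiff_biUnion_mem_cutFamily h1 (fun t => nearBox ((K : ℤ) ^ j) t) T fun t ht =>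
      nearBox_mem_cutBoxes hj (((hTs t ht).trans hs).mono (by linarith))
    exact cutFamily_mono (by omega) h2
  · have hle : (A.filter fun y => c y = s).card ≤ (nearBox ((K : ℤ) ^ j) s).card := by
      refine Finset.card_le_card fun y hy => ?_
      exact mem_nearBox.2 ((hshape y).1 (Finset.mem_filter.1 hy).2).1
    rw [card_nearBox] at hle
    have hb : (2 * (K : ℤ) ^ j - 1).toNat ≤ 2 * K ^ j := by
      rw [Int.toNat_le]
      push_cast
      linarith
    calc ((A.filter fun y => c y = s).card : ℝ) ≤ (((2 * K ^ j) ^ d : ℕ) : ℝ) := by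
          exact_mod_cast hle.trans (Nat.pow_le_pow_left hb d)
      _ = _ := by push_cast; ring

open Classical in
/-- If all test sets have small discrepancy, so have all nested cells near the origin. -/
theorem abs_disc_cell_le {d K k : ℕ} (hK : 2 ≤ K) {c : ℕ → Site d → Site d}
    (hc : ∀ k, IsBoxClustering ((K : ℤ) ^ k) (c k)) {β : ℝ} (hβ0 : β ≤ (d : ℝ) / 2)
    (hKβ : 4 * (straddlingBound d K : ℝ) ≤ (K : ℝ) ^ ((d : ℝ) - β)) (γ : Config d) {l : ℝ}
    (hl : 1 ≤ l)
    (hgood : ∀ A ∈ testSets d K k ((4 ^ d + 1) * k), |disc γ A| ≤ l * Real.sqrt A.card)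
    (j : ℕ) (hj : j ≤ k) (m : ℕ) (hm : m + (4 ^ d + 1) * j ≤ (4 ^ d + 1) * k)
    (A : Finset (Site d)) (hA : A ∈ testSets d K k m) (s : Site d) :
    |disc γ (A.filter fun y => coarse c j y = s)| ≤
      l * (2 * 2 ^ d) * ((K : ℝ) ^ j) ^ ((d : ℝ) - β) := by
  have hK0 : 0 < K := by omega
  have hKr : (1 : ℝ) ≤ K := by exact_mod_cast hK0
  have h2d : (1 : ℝ) ≤ 2 ^ d := one_le_pow₀ (by norm_num)
  -- The comparison also needs the bound for small cells intersected with a box cell, so the test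
  -- set `A` varies. The cut budget `m` grows by `4 ^ d + 1` for each level descended.
  induction j generalizing m A s with
  | zero =>
    have hcard : (A.filter fun y => coarse c 0 y = s).card ≤ 1 := by
      refine Finset.card_le_one.2 fun x hx y hy => ?_
      exact ((Finset.mem_filter.1 hx).2).trans ((Finset.mem_filter.1 hy).2).symm
    have h1 : |disc γ (A.filter fun y => coarse c 0 y = s)| ≤ 1 := by
      refine (Finset.abs_sum_le_sum_abs _ _).trans ?_
      simp only [abs_spin, Finset.sum_const, nsmul_eq_mul, mul_one]
      exact_mod_cast hcard
    rw [pow_zero, Real.one_rpow]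
    nlinarith
  | succ j ih =>
    set F : ℝ := l * (2 * 2 ^ d) * ((K : ℝ) ^ j) ^ ((d : ℝ) - β) with hF
    have hF0 : 0 ≤ F := by positivity
    by_cases hs : ∃ y ∈ A, coarse c (j + 1) y = s
    swap
    · have : A.filter (fun y => coarse c (j + 1) y = s) = ∅ :=
        Finset.filter_eq_empty_iff.2 fun y hy h => hs ⟨y, hy, h⟩
      rw [this]
      simp only [disc, Finset.sum_empty, abs_zero]
      positivity
    obtain ⟨y, hyA, hys⟩ := hs
    have hLk : (K : ℤ) ^ (j + 1) ≤ (K : ℤ) ^ k := pow_le_pow_right₀ (by exact_mod_cast hK0) hj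
    have hs0 : Near (8 * (K : ℤ) ^ k) s 0 := by
      have h1 := near_coarse hK hc (j + 1) y
      rw [hys] at h1
      have h2 := mem_nearBox.1 (subset_of_mem_cutFamily hA hyA)
      exact (h1.symm.trans h2).mono (by linarith)
    obtain ⟨hmem, hcard⟩ := filter_mem_testSets hK0 hj (hc (j + 1)) hA hs0 ⟨_, hys⟩
    have hstep := abs_disc_union_le γ (coarse c j) (c (j + 1)) A s (F := F)
      (N := straddlingBound d K) ?_ ?_ ?_
    rotate_left
    · refine card_straddling_le (l := (K : ℤ) ^ j) (by positivity) hK0 (c := c (j + 1)) ?_ s _ ?_ ?_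
      · rw [← pow_succ']
        exact hc (j + 1)
      · intro t ht u hu
        obtain ⟨t', -, rfl⟩ := Finset.mem_image.1 ht
        obtain ⟨u', -, rfl⟩ := Finset.mem_image.1 hu
        exact coarse_separated hc j t' u'
      · intro t ht
        obtain ⟨t', ht', rfl⟩ := Finset.mem_image.1 ht
        exact ⟨t', near_coarse hK hc j t', (Finset.mem_filter.1 ht').2⟩
    · exact fun t => ih (by omega) m (by rw [mul_add] at hm; omega) A hA t
    · refine fun t => ih (by omega) (m + (4 ^ d + 1)) (by rw [mul_add] at hm; omega) _ hmem t
    -- The box cell is itself a test set; the square root of its volume fits because `d / 2 ≤ d -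
    -- β`. This takes one half of the target.
    have hmain : |disc γ (A.filter fun y => c (j + 1) y = s)| ≤
        l * 2 ^ d * ((K : ℝ) ^ (j + 1)) ^ ((d : ℝ) - β) := by
      refine (hgood _ (cutFamily_mono (by rw [mul_add] at hm; omega) hmem)).trans ?_
      rw [mul_assoc]
      gcongr
      have hKj : (1 : ℝ) ≤ (K : ℝ) ^ (j + 1) := one_le_pow₀ hKr
      rw [Real.sqrt_le_left (by positivity)]
      refine hcard.trans ?_
      rw [mul_pow, mul_pow]
      gcongr
      · exact le_self_pow₀ h2d (by norm_num)
      · rw [← Real.rpow_natCast, ← Real.rpow_natCast (((K : ℝ) ^ (j + 1)) ^ ((d : ℝ) - β)),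
          ← Real.rpow_mul (by positivity)]
        refine Real.rpow_le_rpow_of_exponent_le hKj ?_
        push_cast
        linarith
    -- The cut cells take the other half; this is what `hKβ` is for.
    have hrec : (straddlingBound d K : ℝ) * (2 * F) ≤
        l * 2 ^ d * ((K : ℝ) ^ (j + 1)) ^ ((d : ℝ) - β) := by
      have : ((K : ℝ) ^ (j + 1)) ^ ((d : ℝ) - β) =
          ((K : ℝ) ^ j) ^ ((d : ℝ) - β) * (K : ℝ) ^ ((d : ℝ) - β) := by
        rw [pow_succ, Real.mul_rpow (by positivity) (by positivity)]
      rw [this, hF]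
      have hp : 0 ≤ l * 2 ^ d * ((K : ℝ) ^ j) ^ ((d : ℝ) - β) := by positivity
      nlinarith [mul_le_mul_of_nonneg_left hKβ hp]
    calc _ ≤ _ := hstep
      _ ≤ _ := by linarith

/-! ### Matching within cells, level by level -/

open Classical in
/-- Match every unmatched one at `x` with an unmatched zero at `x + v` in the same cell. -/
noncomputable def matchStep {d : ℕ} (γ : Config d) (a : Site d → Site d) (v : Site d)
    (M : Site d → Site d) (x : Site d) : Site d :=
  if M x = x ∧ M (x + v) = x + v ∧ γ x = true ∧ γ (x + v) = false ∧ a (x + v) = a x then x + v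
  else if M x = x ∧ M (x - v) = x - v ∧ γ x = false ∧ γ (x - v) = true ∧ a (x - v) = a x then x - v
  else M x

/-- `M` is an involution that exchanges ones and zeros off its fixed points, within cells. -/
structure IsPartialMatching {d : ℕ} (γ : Config d) (a : Site d → Site d) (M : Site d → Site d) :
    Prop where
  invol : ∀ x, M (M x) = x
  color : ∀ x, M x ≠ x → γ (M x) ≠ γ x
  cell : ∀ x, a (M x) = a x

theorem matchStep_of_ne {d : ℕ} (γ : Config d) (a : Site d → Site d) (v : Site d)
    {M : Site d → Site d} {x : Site d} (h : M x ≠ x) : matchStep γ a v M x = M x := by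
  simp [matchStep, h]

theorem matchStep_add {d : ℕ} (γ : Config d) (a : Site d → Site d) (v : Site d)
    {M : Site d → Site d} {x : Site d} (h : M x = x ∧ M (x + v) = x + v ∧ γ x = true ∧
      γ (x + v) = false ∧ a (x + v) = a x) :
    matchStep γ a v M x = x + v ∧ matchStep γ a v M (x + v) = x := by
  constructor
  · rw [matchStep, if_pos h]
  · rw [matchStep, if_neg (by rw [h.2.2.2.1]; simp), if_pos, add_sub_cancel_right]
    rw [add_sub_cancel_right]
    exact ⟨h.2.1, h.1, h.2.2.2.1, h.2.2.1, h.2.2.2.2.symm⟩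

theorem matchStep_cases {d : ℕ} (γ : Config d) (a : Site d → Site d) (v : Site d)
    (M : Site d → Site d) (x : Site d) :
    (M x = x ∧ M (x + v) = x + v ∧ γ x = true ∧ γ (x + v) = false ∧ a (x + v) = a x) ∨
    (∃ y, y + v = x ∧ M y = y ∧ M (y + v) = y + v ∧ γ y = true ∧ γ (y + v) = false ∧
      a (y + v) = a y) ∨ matchStep γ a v M x = M x := by
  by_cases h1 : M x = x ∧ M (x + v) = x + v ∧ γ x = true ∧ γ (x + v) = false ∧ a (x + v) = a x
  · exact Or.inl h1
  by_cases h2 : M x = x ∧ M (x - v) = x - v ∧ γ x = false ∧ γ (x - v) = true ∧ a (x - v) = a x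
  · refine Or.inr (Or.inl ⟨x - v, sub_add_cancel _ _, ?_⟩)
    rw [sub_add_cancel]
    exact ⟨h2.2.1, h2.1, h2.2.2.2.1, h2.2.2.1, h2.2.2.2.2.symm⟩
  · exact Or.inr (Or.inr (by rw [matchStep, if_neg h1, if_neg h2]))

/-- The colour of a site decides whether it can only move by `v` or only by `-v`, so the new pairs
are disjoint from each other. They also avoid all old pairs, since only fixed points of `M` are
used. -/
theorem isPartialMatching_matchStep {d : ℕ} {γ : Config d} {a : Site d → Site d}
    {M : Site d → Site d} (hM : IsPartialMatching γ a M) (v : Site d) :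
    IsPartialMatching γ a (matchStep γ a v M) := by
  have key : ∀ x, (matchStep γ a v M (matchStep γ a v M x) = x) ∧
      (matchStep γ a v M x ≠ x → γ (matchStep γ a v M x) ≠ γ x) ∧
      a (matchStep γ a v M x) = a x := by
    intro x
    rcases matchStep_cases γ a v M x with h | ⟨y, rfl, h⟩ | h
    · obtain ⟨h1, h2⟩ := matchStep_add γ a v h
      rw [h1]
      exact ⟨h2, fun _ => by simp [h.2.2.1, h.2.2.2.1], h.2.2.2.2⟩
    · obtain ⟨h1, h2⟩ := matchStep_add γ a v h
      rw [h2]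
      exact ⟨h1, fun _ => by simp [h.2.2.1, h.2.2.2.1], h.2.2.2.2.symm⟩
    · rw [h]
      refine ⟨?_, hM.color x, hM.cell x⟩
      by_cases hx : M x = x
      · rw [hx, h, hx]
      · rw [matchStep_of_ne, hM.invol]
        rw [hM.invol]
        exact Ne.symm hx
  exact ⟨fun x => (key x).1, fun x => (key x).2.1, fun x => (key x).2.2⟩

/-- Run the matching steps along a list of vectors. -/
noncomputable def matchLevel {d : ℕ} (γ : Config d) (a : Site d → Site d) :
    List (Site d) → (Site d → Site d) → Site d → Site d
  | [], M => M
  | v :: l, M => matchLevel γ a l (matchStep γ a v M)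

theorem matchLevel_of_ne {d : ℕ} (γ : Config d) (a : Site d → Site d) (l : List (Site d))
    {M : Site d → Site d} {x : Site d} (h : M x ≠ x) : matchLevel γ a l M x = M x := by
  induction l generalizing M with
  | nil => rfl
  | cons v l ih =>
    have h' := matchStep_of_ne γ a v h
    rw [matchLevel, ih (by rwa [h']), h']

theorem IsPartialMatching.matchLevel {d : ℕ} {γ : Config d} {a : Site d → Site d}
    {M : Site d → Site d} (hM : IsPartialMatching γ a M) (l : List (Site d)) :
    IsPartialMatching γ a (matchLevel γ a l M) := by
  induction l generalizing M with
  | nil => exact hM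
  | cons v l ih => exact ih (isPartialMatching_matchStep hM v)

/-- One pass through the list suffices: pairs are never undone, so two sites free at the end were
free when their difference `v` was treated, and would have been paired if they shared a cell. -/
theorem matchLevel_complete {d : ℕ} {γ : Config d} {a : Site d → Site d} {M : Site d → Site d}
    {l : List (Site d)} {v : Site d} (hv : v ∈ l) {x : Site d} (hx : matchLevel γ a l M x = x)
    (hy : matchLevel γ a l M (x + v) = x + v) (h1 : γ x = true) (h2 : γ (x + v) = false) :
    a (x + v) ≠ a x := by
  induction l generalizing M with
  | nil => exact absurd hv List.not_mem_nil
  | cons w l ih =>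
    rcases List.mem_cons.1 hv with rfl | hv
    · intro ha
      have hfix : ∀ z, matchLevel γ a (v :: l) M z = z → M z = z := by
        intro z hz
        by_contra hne
        rw [matchLevel_of_ne γ a _ hne] at hz
        exact hne hz
      have hs := (matchStep_add γ a v ⟨hfix x hx, hfix _ hy, h1, h2, ha⟩).1
      have hne : matchStep γ a v M x ≠ x := by
        rw [hs]
        intro h
        rw [h, h1] at h2
        exact absurd h2 (by simp)
      have h' := matchLevel_of_ne γ a l hne
      rw [matchLevel] at hx
      exact hne (h'.symm.trans hx)
    · exact ih hv hx hy

/-- The partial matching after level `k`. -/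
noncomputable def matchUpTo {d : ℕ} (K : ℕ) (γ : Config d) (a : ℕ → Site d → Site d) :
    ℕ → Site d → Site d
  | 0 => id
  | k + 1 => matchLevel γ (a (k + 1)) (nearBox (4 * (K : ℤ) ^ (k + 1)) 0).toList
      (matchUpTo K γ a k)

theorem isPartialMatching_matchUpTo {d : ℕ} (K : ℕ) (γ : Config d) (c : ℕ → Site d → Site d)
    (k : ℕ) : IsPartialMatching γ (coarse c k) (matchUpTo K γ (coarse c) k) := by
  induction k with
  | zero => exact ⟨fun _ => rfl, fun x h => absurd rfl h, fun _ => rfl⟩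
  | succ k ih =>
    refine IsPartialMatching.matchLevel ⟨ih.invol, ih.color, fun x => ?_⟩ _
    exact congrArg (c (k + 1)) (ih.cell x)

theorem matchUpTo_of_ne {d : ℕ} {K : ℕ} {γ : Config d} {a : ℕ → Site d → Site d} {j k : ℕ}
    (hjk : j ≤ k) {x : Site d} (h : matchUpTo K γ a j x ≠ x) :
    matchUpTo K γ a k x = matchUpTo K γ a j x := by
  induction k, hjk using Nat.le_induction with
  | base => rfl
  | succ k _ ih => rw [matchUpTo, matchLevel_of_ne _ _ _ (by rwa [ih]), ih]

theorem near_of_coarse_eq {d : ℕ} {K : ℕ} (hK : 2 ≤ K) {c : ℕ → Site d → Site d}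
    (hc : ∀ k, IsBoxClustering ((K : ℤ) ^ k) (c k)) {k : ℕ} {x y : Site d}
    (h : coarse c k x = coarse c k y) : Near (4 * (K : ℤ) ^ k) x y := by
  have h1 := near_coarse hK hc k x
  rw [h] at h1
  exact (h1.trans (near_coarse hK hc k y).symm).mono (by linarith)

/-- After level `k`, the unmatched sites of a cell of level `k` have the same colour. -/
theorem matchUpTo_monochromatic {d : ℕ} {K : ℕ} (hK : 2 ≤ K) {c : ℕ → Site d → Site d}
    (hc : ∀ k, IsBoxClustering ((K : ℤ) ^ k) (c k)) (γ : Config d) {k : ℕ} {x y : Site d}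
    (hxy : coarse c k x = coarse c k y) (hx : matchUpTo K γ (coarse c) k x = x)
    (hy : matchUpTo K γ (coarse c) k y = y) : γ x = γ y := by
  cases k with
  | zero => exact congrArg γ hxy
  | succ k =>
    have key : ∀ x y, coarse c (k + 1) x = coarse c (k + 1) y →
        matchUpTo K γ (coarse c) (k + 1) x = x → matchUpTo K γ (coarse c) (k + 1) y = y →
        γ x = true → γ y = false → False := by
      intro x y hxy hx hy h1 h2
      have hn := near_of_coarse_eq hK hc hxy
      have hv : y - x ∈ (nearBox (4 * (K : ℤ) ^ (k + 1)) (0 : Site d)).toList := by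
        rw [Finset.mem_toList, mem_nearBox]
        intro i
        simpa using hn.symm i
      have hyx : x + (y - x) = y := add_sub_cancel x y
      exact matchLevel_complete hv hx (by rw [hyx]; exact hy) h1 (by rw [hyx]; exact h2)
        (by rw [hyx]; exact hxy.symm)
    rcases hbx : γ x <;> rcases hby : γ y
    · rfl
    · exact (key y x hxy.symm hy hx hby hbx).elim
    · exact (key x y hxy hx hy hbx hby).elim
    · rfl

open Classical in
/-- The number of unmatched sites of a cell is at most its discrepancy. -/
theorem card_unmatched_le {d : ℕ} {γ : Config d} {a M : Site d → Site d}
    (hM : IsPartialMatching γ a M) {s : Site d} (C : Finset (Site d)) (hC : ∀ x, x ∈ C ↔ a x = s)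
    (hmono : ∀ x y, a x = a y → M x = x → M y = y → γ x = γ y) :
    ((C.filter fun x => M x = x).card : ℝ) ≤ |disc γ C| := by
  -- Matched pairs stay inside the cell and have opposite spins, so they cancel and the discrepancy
  -- is carried by the unmatched sites.
  have hzero : ∑ x ∈ C.filter (fun x => ¬M x = x), spin γ x = 0 := by
    refine Finset.sum_involution (fun x _ => M x) ?_ ?_ ?_ ?_
    · intro x hx
      have := hM.color x (Finset.mem_filter.1 hx).2
      unfold spin
      cases h1 : γ x <;> cases h2 : γ (M x) <;> simp_all
    · intro x hx _
      exact (Finset.mem_filter.1 hx).2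
    · intro x hx
      rw [Finset.mem_filter, hC] at hx ⊢
      rw [hM.cell, hM.invol]
      exact ⟨hx.1, fun h => hx.2 h.symm⟩
    · intro x _
      exact hM.invol x
  have hsplit : disc γ C = ∑ x ∈ C.filter (fun x => M x = x), spin γ x := by
    rw [disc, ← Finset.sum_filter_add_sum_filter_not C (fun x => M x = x), hzero, add_zero]
  rcases (C.filter fun x => M x = x).eq_empty_or_nonempty with he | ⟨y, hy⟩
  · rw [he]
    simp
  · have hconst : ∀ x ∈ C.filter (fun x => M x = x), spin γ x = spin γ y := by
      intro x hx
      rw [Finset.mem_filter, hC] at hx hy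
      unfold spin
      rw [hmono x y (hx.1.trans hy.1.symm) hx.2 hy.2]
    rw [hsplit, Finset.sum_congr rfl hconst, Finset.sum_const, nsmul_eq_mul, abs_mul, abs_spin]
    simp

open Classical in
/-- The limit of the partial matchings. -/
noncomputable def limitMatch {d : ℕ} (M : ℕ → Site d → Site d) (x : Site d) : Site d :=
  if h : ∃ k, M k x ≠ x then M (Nat.find h) x else x

theorem limitMatch_eq {d : ℕ} {K : ℕ} {γ : Config d} {a : ℕ → Site d → Site d} {k : ℕ}
    {x : Site d} (h : matchUpTo K γ a k x ≠ x) :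
    limitMatch (matchUpTo K γ a) x = matchUpTo K γ a k x := by
  classical
  have h' : ∃ k, matchUpTo K γ a k x ≠ x := ⟨k, h⟩
  rw [limitMatch, dif_pos h']
  exact (matchUpTo_of_ne (Nat.find_min' h' h) (Nat.find_spec h')).symm

theorem isMatching_limitMatch {d : ℕ} {K : ℕ} {γ : Config d} {c : ℕ → Site d → Site d}
    (h : ∀ x, ∃ k, matchUpTo K γ (coarse c) k x ≠ x) :
    IsMatching γ (limitMatch (matchUpTo K γ (coarse c))) := by
  have hinv : ∀ x, limitMatch (matchUpTo K γ (coarse c))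
      (limitMatch (matchUpTo K γ (coarse c)) x) = x := by
    intro x
    obtain ⟨k, hk⟩ := h x
    have hM := isPartialMatching_matchUpTo K γ c k
    rw [limitMatch_eq hk, limitMatch_eq (k := k), hM.invol]
    rw [hM.invol]
    exact hk.symm
  have hcol : ∀ x, γ (limitMatch (matchUpTo K γ (coarse c)) x) ≠ γ x := by
    intro x
    obtain ⟨k, hk⟩ := h x
    rw [limitMatch_eq hk]
    exact (isPartialMatching_matchUpTo K γ c k).color x hk
  refine ⟨Function.Involutive.bijective hinv, ?_, ?_, funext hinv⟩
  · intro x hx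
    have := hcol x
    rw [hx] at this
    simpa using this
  · intro x hx
    have := hcol x
    rw [hx] at this
    simpa using this

theorem limitMatch_near {d : ℕ} {K : ℕ} (hK : 2 ≤ K) {γ : Config d} {c : ℕ → Site d → Site d}
    (hc : ∀ k, IsBoxClustering ((K : ℤ) ^ k) (c k)) {k : ℕ} {x : Site d}
    (h : matchUpTo K γ (coarse c) k x ≠ x) :
    Near (4 * (K : ℤ) ^ k) (limitMatch (matchUpTo K γ (coarse c)) x) x := by
  rw [limitMatch_eq h]
  exact near_of_coarse_eq hK hc ((isPartialMatching_matchUpTo K γ c k).cell x)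

/-! ### Equivariance and measurability of the matching -/

theorem coarse_shift {d : ℕ} {c c' : ℕ → Site d → Site d} {z : Site d}
    (h : ∀ k x, c' k (x + z) = c k x + z) (k : ℕ) (x : Site d) :
    coarse c' k (x + z) = coarse c k x + z := by
  induction k with
  | zero => rfl
  | succ k ih =>
    change c' (k + 1) (coarse c' k (x + z)) = _
    rw [ih, h]
    rfl

theorem matchStep_shift {d : ℕ} (γ : Config d) {a a' M M' : Site d → Site d} {z : Site d}
    (ha : ∀ x, a' (x + z) = a x + z) (hM : ∀ x, M' (x + z) = M x + z) (v x : Site d) :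
    matchStep (shiftConfig z γ) a' v M' (x + z) = matchStep γ a v M x + z := by
  have h1 : x + z + v = x + v + z := by abel
  have h2 : x + z - v = x - v + z := by abel
  simp only [matchStep, h1, h2, ha, hM, shiftConfig_add, add_left_inj]
  split_ifs <;> rfl

theorem matchLevel_shift {d : ℕ} (γ : Config d) {a a' M M' : Site d → Site d} {z : Site d}
    (ha : ∀ x, a' (x + z) = a x + z) (hM : ∀ x, M' (x + z) = M x + z) (l : List (Site d))
    (x : Site d) :
    matchLevel (shiftConfig z γ) a' l M' (x + z) = matchLevel γ a l M x + z := by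
  induction l generalizing M M' with
  | nil => exact hM x
  | cons v l ih => exact ih (matchStep_shift γ ha hM v)

theorem matchUpTo_shift {d : ℕ} (K : ℕ) (γ : Config d) {a a' : ℕ → Site d → Site d} {z : Site d}
    (ha : ∀ k x, a' k (x + z) = a k x + z) (k : ℕ) (x : Site d) :
    matchUpTo K (shiftConfig z γ) a' k (x + z) = matchUpTo K γ a k x + z := by
  induction k generalizing x with
  | zero => rfl
  | succ k ih => exact matchLevel_shift γ (ha (k + 1)) ih _ x

theorem limitMatch_shift {d : ℕ} {M M' : ℕ → Site d → Site d} {z : Site d}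
    (hM : ∀ k x, M' k (x + z) = M k x + z) (x : Site d) :
    limitMatch M' (x + z) = limitMatch M x + z := by
  classical
  have he : ∀ k, M' k (x + z) ≠ x + z ↔ M k x ≠ x := fun k => by rw [hM]; simp
  by_cases h : ∃ k, M k x ≠ x
  · have h' : ∃ k, M' k (x + z) ≠ x + z := h.imp fun k hk => (he k).2 hk
    have hf : Nat.find h' = Nat.find h := (Nat.find_eq_iff h').2
      ⟨(he _).2 (Nat.find_spec h), fun j hj hc => Nat.find_min h hj ((he j).1 hc)⟩
    rw [limitMatch, limitMatch, dif_pos h, dif_pos h', hf, hM]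
  · have h' : ¬∃ k, M' k (x + z) ≠ x + z := fun ⟨k, hk⟩ => h ⟨k, (he k).1 hk⟩
    rw [limitMatch, limitMatch, dif_neg h, dif_neg h']

theorem measurable_matchStep {d : ℕ} {a M : Config d → Site d → Site d}
    (ha : ∀ x, Measurable fun γ => a γ x) (hM : ∀ x, Measurable fun γ => M γ x) (v x : Site d) :
    Measurable fun γ => matchStep γ (a γ) v (M γ) x := by
  classical
  have hfix : ∀ y, MeasurableSet {γ | M γ y = y} := fun y =>
    measurableSet_eq_fun (hM y) measurable_const
  have hcell : ∀ y, MeasurableSet {γ | a γ y = a γ x} := fun y =>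
    measurableSet_eq_fun (ha y) (ha x)
  have hcol : ∀ y b, MeasurableSet {γ : Config d | γ y = b} := fun y b =>
    measurableSet_setOfPred.2 (measurable_eval_eq y b)
  refine Measurable.ite ?_ measurable_const (Measurable.ite ?_ measurable_const (hM x))
  · exact (hfix _).inter ((hfix _).inter ((hcol _ _).inter ((hcol _ _).inter (hcell _))))
  · exact (hfix _).inter ((hfix _).inter ((hcol _ _).inter ((hcol _ _).inter (hcell _))))

theorem measurable_matchLevel {d : ℕ} {a M : Config d → Site d → Site d}
    (ha : ∀ x, Measurable fun γ => a γ x) (hM : ∀ x, Measurable fun γ => M γ x)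
    (l : List (Site d)) (x : Site d) : Measurable fun γ => matchLevel γ (a γ) l (M γ) x := by
  induction l generalizing M with
  | nil => exact hM x
  | cons v l ih => exact ih (measurable_matchStep ha hM v)

theorem measurable_matchUpTo {d : ℕ} (K : ℕ) {a : Config d → ℕ → Site d → Site d}
    (ha : ∀ k x, Measurable fun γ => a γ k x) (k : ℕ) (x : Site d) :
    Measurable fun γ => matchUpTo K γ (a γ) k x := by
  induction k generalizing x with
  | zero => exact measurable_const
  | succ k ih => exact measurable_matchLevel (ha (k + 1)) ih _ x

theorem measurable_coarse {d : ℕ} {c : Config d → ℕ → Site d → Site d}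
    (hc : ∀ k x, Measurable fun γ => c γ k x) (k : ℕ) (x : Site d) :
    Measurable fun γ => coarse (c γ) k x := by
  induction k with
  | zero => exact measurable_const
  | succ k ih =>
    have : Measurable (Function.uncurry fun (γ : Config d) y => c γ (k + 1) y) :=
      measurable_from_prod_countable_left fun y => hc (k + 1) y
    exact this.comp (measurable_id.prodMk ih)

theorem measurable_limitMatch {d : ℕ} {M : Config d → ℕ → Site d → Site d}
    (hM : ∀ k x, Measurable fun γ => M γ k x) (x : Site d) :
    Measurable fun γ => limitMatch (M γ) x := by
  classical
  have hne : ∀ k, MeasurableSet {γ | M γ k x ≠ x} := fun k =>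
    (measurableSet_eq_fun (hM k x) measurable_const).compl
  refine measurable_to_countable' fun y => ?_
  have : (fun γ => limitMatch (M γ) x) ⁻¹' {y} =
      (⋃ k, (({γ | M γ k x ≠ x} ∩ ⋂ j ∈ Finset.range k, {γ | M γ j x ≠ x}ᶜ) ∩
        {γ | M γ k x = y})) ∪ ((⋂ k, {γ | M γ k x ≠ x}ᶜ) ∩ {γ | x = y}) := by
    ext γ
    simp only [Set.mem_preimage, Set.mem_singleton_iff, Set.mem_union, Set.mem_iUnion,
      Set.mem_inter_iff, Set.mem_iInter, Set.mem_compl_iff, Set.mem_ofPred_eq, Finset.mem_range]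
    by_cases h : ∃ k, M γ k x ≠ x
    · rw [limitMatch, dif_pos h]
      constructor
      · intro hy
        exact Or.inl ⟨Nat.find h, ⟨Nat.find_spec h, fun j hj => Nat.find_min h hj⟩, hy⟩
      · rintro (⟨k, ⟨hk, hlt⟩, hy⟩ | ⟨hall, -⟩)
        · rwa [(Nat.find_eq_iff h).2 ⟨hk, hlt⟩]
        · obtain ⟨k, hk⟩ := h
          exact absurd hk (hall k)
    · rw [limitMatch, dif_neg h]
      constructor
      · intro hy
        exact Or.inr ⟨fun k hk => h ⟨k, hk⟩, hy⟩
      · rintro (⟨k, ⟨hk, -⟩, -⟩ | ⟨-, hy⟩)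
        · exact absurd ⟨k, hk⟩ h
        · exact hy
  rw [this]
  refine (MeasurableSet.iUnion fun k => ((hne k).inter (Finset.measurableSet_biInter _
    fun j _ => (hne j).compl)).inter (measurableSet_eq_fun (hM k x) measurable_const)).union
    ((MeasurableSet.iInter fun k => (hne k).compl).inter (MeasurableSet.const _))

/-! ### Probability of being unmatched after level `k` -/

open Classical in
theorem card_unmatched_box_le {d K k : ℕ} (hK : 2 ≤ K) {c : ℕ → Site d → Site d}
    (hc : ∀ k, IsBoxClustering ((K : ℤ) ^ k) (c k)) {β : ℝ} (hβ0 : β ≤ (d : ℝ) / 2)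
    (hKβ : 4 * (straddlingBound d K : ℝ) ≤ (K : ℝ) ^ ((d : ℝ) - β)) (γ : Config d) {l : ℝ}
    (hl : 1 ≤ l)
    (hgood : ∀ A ∈ testSets d K k ((4 ^ d + 1) * k), |disc γ A| ≤ l * Real.sqrt A.card) :
    (((nearBox ((K : ℤ) ^ k) 0).filter fun x => matchUpTo K γ (coarse c) k x = x).card : ℝ) ≤
      6 ^ d * (l * (2 * 2 ^ d) * ((K : ℝ) ^ k) ^ ((d : ℝ) - β)) := by
  set B : Finset (Site d) := nearBox ((K : ℤ) ^ k) 0 with hB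
  set A : Finset (Site d) := nearBox (6 * (K : ℤ) ^ k) 0 with hA
  set F : ℝ := l * (2 * 2 ^ d) * ((K : ℝ) ^ k) ^ ((d : ℝ) - β) with hF
  set M := matchUpTo K γ (coarse c) k with hM
  have hL : (0 : ℤ) < (K : ℤ) ^ k := by positivity
  have hcells : (B.image (coarse c k)).card ≤ 6 ^ d := by
    have := card_le_prod_of_separated hL (B.image (coarse c k)) ?_
      (fun _ => -(3 * (K : ℤ) ^ k)) (fun _ => 6) ?_
    · simpa using this
    · intro t ht u hu
      obtain ⟨t', -, rfl⟩ := Finset.mem_image.1 ht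
      obtain ⟨u', -, rfl⟩ := Finset.mem_image.1 hu
      exact coarse_separated hc k t' u'
    · intro t ht i
      obtain ⟨y, hy, rfl⟩ := Finset.mem_image.1 ht
      have h := abs_lt.1 (((near_coarse hK hc k y).symm.trans (mem_nearBox.1 hy)) i)
      simp only [Pi.zero_apply, sub_zero] at h
      push_cast
      constructor <;> linarith
  have hcover : B.filter (fun x => M x = x) ⊆ (B.image (coarse c k)).biUnion fun s =>
      (A.filter fun y => coarse c k y = s).filter fun x => M x = x := by
    intro x hx
    rw [Finset.mem_filter] at hx
    refine Finset.mem_biUnion.2 ⟨_, Finset.mem_image_of_mem _ hx.1, Finset.mem_filter.2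
      ⟨Finset.mem_filter.2 ⟨mem_nearBox.2 ((mem_nearBox.1 hx.1).mono (by linarith)), rfl⟩, hx.2⟩⟩
  have hcell : ∀ s ∈ B.image (coarse c k),
      (((A.filter fun y => coarse c k y = s).filter fun x => M x = x).card : ℝ) ≤ F := by
    intro s hs
    obtain ⟨y, hy, rfl⟩ := Finset.mem_image.1 hs
    refine (card_unmatched_le (isPartialMatching_matchUpTo K γ c k) (s := coarse c k y) _ ?_
      fun x y => matchUpTo_monochromatic hK hc γ).trans ?_
    · intro x
      rw [Finset.mem_filter]
      refine ⟨fun h => h.2, fun h => ⟨mem_nearBox.2 ?_, h⟩⟩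
      exact ((near_of_coarse_eq hK hc h).trans (mem_nearBox.1 hy)).mono (by linarith)
    · exact abs_disc_cell_le hK hc hβ0 hKβ γ hl hgood k le_rfl 0 (by simp) A
        (Finset.mem_singleton_self _) _
  have hsum := (Finset.card_le_card hcover).trans Finset.card_biUnion_le
  calc ((B.filter fun x => M x = x).card : ℝ) ≤ ∑ s ∈ B.image (coarse c k),
      (((A.filter fun y => coarse c k y = s).filter fun x => M x = x).card : ℝ) := by
        exact_mod_cast hsum
    _ ≤ (B.image (coarse c k)).card • F := Finset.sum_le_card_nsmul _ _ _ hcell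
    _ ≤ 6 ^ d * F := by
      rw [nsmul_eq_mul]
      have : 0 ≤ F := by positivity
      gcongr
      exact_mod_cast hcells

/-- The configurations for which some test set has large discrepancy. -/
def badSet (d K k : ℕ) (l : ℝ) : Set (Config d) :=
  ⋃ A ∈ testSets d K k ((4 ^ d + 1) * k), {γ | l * Real.sqrt A.card < |disc γ A|}

theorem measurableSet_badSet (d K k : ℕ) (l : ℝ) : MeasurableSet (badSet d K k l) :=
  Finset.measurableSet_biUnion _ fun A _ =>
    measurableSet_lt measurable_const (continuous_abs.measurable.comp (measurable_disc A))

theorem card_testSets_le {d K k : ℕ} (hK : 2 ≤ K) (hk : 1 ≤ k) (m : ℕ) :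
    (testSets d K k m).card ≤ ((8 * (20 * K) ^ d) ^ k) ^ m := by
  classical
  refine (card_cutFamily_le _ _ _).trans (Nat.pow_le_pow_left ?_ m)
  have h1 : (cutBoxes d K k).card ≤ (k + 1) * (20 * K ^ k) ^ d := by
    refine Finset.card_image_le.trans ?_
    rw [Finset.card_product, Finset.card_range, card_nearBox]
    gcongr
    rw [Int.toNat_le]
    push_cast
    linarith
  have h2 : k + 1 ≤ 2 ^ k := Nat.lt_two_pow_self
  have h3 : 1 ≤ (20 * K ^ k) ^ d := Nat.one_le_pow _ _ (by positivity)
  have h4 : (20 * K ^ k) ^ d ≤ ((20 * K) ^ d) ^ k := by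
    rw [← pow_mul, mul_comm d k, pow_mul, mul_pow 20 K k]
    gcongr
    exact Nat.le_self_pow (by omega) 20
  have h5 : 4 ≤ 4 ^ k := Nat.le_self_pow (by omega) 4
  have h6 : 1 + 2 * (cutBoxes d K k).card ≤ 4 * ((k + 1) * (20 * K ^ k) ^ d) := by nlinarith
  calc _ ≤ _ := h6
    _ ≤ 4 ^ k * (2 ^ k * ((20 * K) ^ d) ^ k) := by gcongr
    _ = _ := by rw [← mul_pow, ← mul_pow, ← mul_assoc]; norm_num

theorem measureReal_badSet_le {d K k : ℕ} (hK : 2 ≤ K) (hk : 1 ≤ k) {X C : ℝ}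
    (hX : X = (4 ^ d + 1) * Real.log (8 * (20 * K) ^ d) + Real.log 2 + Real.log K)
    (hC0 : 0 ≤ C) (hC : X ≤ C ^ 2 / 2) :
    (coinFlips d).real (badSet d K k (C * k)) ≤ ((K : ℝ) ^ k)⁻¹ := by
  have hKr : (2 : ℝ) ≤ K := by exact_mod_cast hK
  have hkr : (1 : ℝ) ≤ k := by exact_mod_cast hk
  set G : ℝ := 8 * (20 * K) ^ d with hG
  have hGpos : 0 < G := by positivity
  have h1 : (coinFlips d).real (badSet d K k (C * k)) ≤
      (G ^ k) ^ ((4 ^ d + 1) * k) * (2 * Real.exp (-(C * k) ^ 2 / 2)) := by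
    refine (measureReal_biUnion_finset_le _ _).trans ?_
    refine (Finset.sum_le_card_nsmul _ _ _ fun A _ =>
      measureReal_abs_disc_gt A (l := C * k) (by positivity)).trans ?_
    rw [nsmul_eq_mul]
    gcongr
    have := card_testSets_le (d := d) hK hk ((4 ^ d + 1) * k)
    rw [hG]
    exact_mod_cast this
  refine h1.trans ?_
  have h2 : (G ^ k) ^ ((4 ^ d + 1) * k) =
      Real.exp ((4 ^ d + 1) * (k : ℝ) ^ 2 * Real.log G) := by
    rw [← pow_mul, ← Real.exp_log (pow_pos hGpos _), Real.log_pow]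
    congr 1
    push_cast
    ring
  have h3 : ((K : ℝ) ^ k)⁻¹ = Real.exp (-(k * Real.log K)) := by
    rw [Real.exp_neg, ← Real.log_pow, Real.exp_log (by positivity)]
  have h4 : 2 * Real.exp (-(C * k) ^ 2 / 2) = Real.exp (Real.log 2 + -(C * k) ^ 2 / 2) := by
    rw [Real.exp_add, Real.exp_log (by norm_num)]
  rw [h2, h3, h4, ← Real.exp_add]
  refine Real.exp_le_exp.2 ?_
  have hl2 : 0 ≤ Real.log 2 := Real.log_nonneg (by norm_num)
  have hlK : 0 ≤ Real.log K := Real.log_nonneg (by linarith)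
  have hk2 : (k : ℝ) ≤ (k : ℝ) ^ 2 := by nlinarith
  have h5 := mul_le_mul_of_nonneg_right hC (sq_nonneg (k : ℝ))
  rw [hX] at h5
  have h6 := mul_le_mul_of_nonneg_right hk2 hlK
  have h7 : Real.log 2 * 1 ≤ Real.log 2 * (k : ℝ) ^ 2 := by gcongr; nlinarith
  nlinarith

theorem measureReal_unmatched_eq {d K : ℕ} {c : Config d → ℕ → Site d → Site d}
    (hm : ∀ k x, Measurable fun γ => c γ k x)
    (hs : ∀ z γ k x, c (shiftConfig z γ) k (x + z) = c γ k x + z) (k : ℕ) (x : Site d) :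
    (coinFlips d).real {γ | matchUpTo K γ (coarse (c γ)) k x = x} =
      (coinFlips d).real {γ | matchUpTo K γ (coarse (c γ)) k 0 = 0} := by
  have hmeas : MeasurableSet {γ | matchUpTo K γ (coarse (c γ)) k x = x} :=
    measurableSet_eq_fun (measurable_matchUpTo K (measurable_coarse hm) k x) measurable_const
  have hpre : shiftConfig x ⁻¹' {γ | matchUpTo K γ (coarse (c γ)) k x = x} =
      {γ | matchUpTo K γ (coarse (c γ)) k 0 = 0} := by
    ext γ
    have := matchUpTo_shift K γ (coarse_shift (hs x γ)) k 0
    rw [zero_add] at this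
    change matchUpTo K (shiftConfig x γ) (coarse (c (shiftConfig x γ))) k x = x ↔
      matchUpTo K γ (coarse (c γ)) k 0 = 0
    rw [this]
    simp
  rw [← hpre, ← map_measureReal_apply (measurable_shiftConfig x) hmeas, map_shiftConfig]

theorem measureReal_unmatched_le {d K : ℕ} (hK : 2 ≤ K) {c : Config d → ℕ → Site d → Site d}
    (hm : ∀ k x, Measurable fun γ => c γ k x)
    (hs : ∀ z γ k x, c (shiftConfig z γ) k (x + z) = c γ k x + z)
    (hc : ∀ γ, Aperiodic γ → ∀ k, IsBoxClustering ((K : ℤ) ^ k) (c γ k))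
    {β : ℝ} (hβ0 : β ≤ (d : ℝ) / 2) (hβ1 : β ≤ 1)
    (hKβ : 4 * (straddlingBound d K : ℝ) ≤ (K : ℝ) ^ ((d : ℝ) - β)) :
    ∃ D : ℝ, 0 < D ∧ ∀ k : ℕ, 1 ≤ k →
      (coinFlips d).real {γ | matchUpTo K γ (coarse (c γ)) k 0 = 0} ≤
        D * k * ((K : ℝ) ^ k) ^ (-β) := by
  classical
  set X : ℝ := (4 ^ d + 1) * Real.log (8 * (20 * K) ^ d) + Real.log 2 + Real.log K with hX
  have hKr : (2 : ℝ) ≤ K := by exact_mod_cast hK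
  have hX0 : 0 ≤ X := by
    have h1 : 0 ≤ Real.log (8 * (20 * (K : ℝ)) ^ d) := by
      refine Real.log_nonneg ?_
      have : (1 : ℝ) ≤ (20 * K) ^ d := one_le_pow₀ (by linarith)
      linarith
    have h2 : 0 ≤ Real.log 2 := Real.log_nonneg (by norm_num)
    have h3 : 0 ≤ Real.log K := Real.log_nonneg (by linarith)
    positivity
  set C : ℝ := 1 + 2 * X with hCdef
  have hC1 : 1 ≤ C := by linarith
  have hC : X ≤ C ^ 2 / 2 := by nlinarith [sq_nonneg X]
  refine ⟨6 ^ d * (C * (2 * 2 ^ d)) + 1, by positivity, fun k hk => ?_⟩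
  have hkr : (1 : ℝ) ≤ k := by exact_mod_cast hk
  have hL : (1 : ℝ) ≤ (K : ℝ) ^ k := one_le_pow₀ (by linarith)
  have hL0 : (0 : ℝ) < (K : ℝ) ^ k := by linarith
  set p := (coinFlips d).real {γ | matchUpTo K γ (coarse (c γ)) k 0 = 0} with hp
  set B : Finset (Site d) := nearBox ((K : ℤ) ^ k) 0 with hB
  set bad := badSet d K k (C * k) with hbad
  set F : ℝ := C * k * (2 * 2 ^ d) * ((K : ℝ) ^ k) ^ ((d : ℝ) - β) with hF
  have hF0 : 0 ≤ F := by positivity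
  have hE : ∀ x, MeasurableSet {γ | matchUpTo K γ (coarse (c γ)) k x = x} := fun x =>
    measurableSet_eq_fun (measurable_matchUpTo K (measurable_coarse hm) k x) measurable_const
  have hbadm : MeasurableSet bad := measurableSet_badSet _ _ _ _
  have hbadi : Integrable (bad.indicator 1 : Config d → ℝ) (coinFlips d) :=
    (integrable_const (1 : ℝ)).indicator hbadm
  have hcardB : ((K : ℝ) ^ k) ^ d ≤ B.card := by
    rw [hB, card_nearBox]
    have : K ^ k ≤ (2 * (K : ℤ) ^ k - 1).toNat := by
      have : (1 : ℤ) ≤ (K : ℤ) ^ k := one_le_pow₀ (by omega)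
      rw [Int.le_toNat (by linarith)]
      push_cast
      linarith
    exact_mod_cast Nat.pow_le_pow_left this d
  have hsum : (B.card : ℝ) * p = ∫ γ, ∑ x ∈ B,
      ({γ | matchUpTo K γ (coarse (c γ)) k x = x}.indicator 1 γ : ℝ) ∂(coinFlips d) := by
    rw [integral_finsetSum]
    · simp_rw [integral_indicator_one (hE _), measureReal_unmatched_eq hm hs]
      simp [hp]
    · exact fun x _ => (integrable_const (1 : ℝ)).indicator (hE x)
  have hle : (B.card : ℝ) * p ≤ 6 ^ d * F + B.card * (coinFlips d).real bad := by
    have hrhs : 6 ^ d * F + B.card * (coinFlips d).real bad =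
        ∫ γ, (6 ^ d * F + B.card * (bad.indicator 1 γ : ℝ)) ∂(coinFlips d) := by
      rw [integral_add (integrable_const _) (hbadi.const_mul _),
        integral_const_mul (B.card : ℝ), integral_indicator_one hbadm]
      simp
    rw [hsum, hrhs]
    refine integral_mono_ae (integrable_finsetSum _ fun x _ =>
      (integrable_const (1 : ℝ)).indicator (hE x)) ((integrable_const _).add
      (hbadi.const_mul _)) ?_
    filter_upwards [ae_aperiodic d] with γ hγ
    have hcount : ∑ x ∈ B, ({γ | matchUpTo K γ (coarse (c γ)) k x = x}.indicator 1 γ : ℝ) =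
        ((B.filter fun x => matchUpTo K γ (coarse (c γ)) k x = x).card : ℝ) := by
      rw [Finset.card_filter]
      push_cast
      refine Finset.sum_congr rfl fun x _ => ?_
      simp [Set.indicator_apply]
    rw [hcount]
    by_cases hb : γ ∈ bad
    · rw [Set.indicator_of_mem hb]
      have h1 : ((B.filter fun x => matchUpTo K γ (coarse (c γ)) k x = x).card : ℝ) ≤ B.card := by
        exact_mod_cast Finset.card_filter_le _ _
      have h2 : (0 : ℝ) ≤ 6 ^ d * F := by positivity
      simp only [Pi.one_apply]
      linarith
    · rw [Set.indicator_of_notMem hb, mul_zero, add_zero]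
      refine card_unmatched_box_le hK (hc γ hγ) hβ0 hKβ γ (by nlinarith) fun A hA => ?_
      by_contra hcon
      exact hb (Set.mem_biUnion (x := A) hA (not_le.1 hcon))
  have hbadle : (coinFlips d).real bad ≤ k * ((K : ℝ) ^ k) ^ (-β) := by
    refine (measureReal_badSet_le hK hk hX (by linarith) hC).trans ?_
    rw [← Real.rpow_neg_one]
    have h1 : ((K : ℝ) ^ k) ^ (-1 : ℝ) ≤ ((K : ℝ) ^ k) ^ (-β) :=
      Real.rpow_le_rpow_of_exponent_le hL (by linarith)
    have h2 : (0 : ℝ) ≤ ((K : ℝ) ^ k) ^ (-β) := by positivity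
    nlinarith
  have hBpos : (0 : ℝ) < B.card := lt_of_lt_of_le (by positivity) hcardB
  have hFB : 6 ^ d * F / B.card ≤ 6 ^ d * (C * (2 * 2 ^ d)) * k * ((K : ℝ) ^ k) ^ (-β) := by
    rw [div_le_iff₀ hBpos]
    have hsplit : ((K : ℝ) ^ k) ^ ((d : ℝ) - β) = ((K : ℝ) ^ k) ^ (-β) * ((K : ℝ) ^ k) ^ d := by
      rw [← Real.rpow_natCast ((K : ℝ) ^ k) d, ← Real.rpow_add hL0]
      congr 1
      ring
    calc 6 ^ d * F = 6 ^ d * (C * (2 * 2 ^ d)) * k * ((K : ℝ) ^ k) ^ (-β) * ((K : ℝ) ^ k) ^ d := by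
          rw [hF, hsplit]; ring
      _ ≤ _ := by gcongr
  have hp' : p ≤ 6 ^ d * F / B.card + (coinFlips d).real bad := by
    rw [← sub_le_iff_le_add, le_div_iff₀ hBpos]
    linarith
  linarith

theorem exists_scale (d : ℕ) {β : ℝ} (hβ : β < 1) (hd : 1 ≤ d) :
    ∃ K : ℕ, 2 ≤ K ∧ 4 * (straddlingBound d K : ℝ) ≤ (K : ℝ) ^ ((d : ℝ) - β) := by
  set Q : ℝ := 4 * ((4 ^ d + 1) * (d * 2) * 4 * 4 ^ (d - 1)) with hQ
  have hlim : Filter.Tendsto (fun K : ℕ => (K : ℝ) ^ (1 - β)) Filter.atTop Filter.atTop :=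
    (tendsto_rpow_atTop (by linarith)).comp tendsto_natCast_atTop_atTop
  obtain ⟨K, hKQ, hK⟩ := ((hlim.eventually_ge_atTop Q).and (Filter.eventually_ge_atTop 2)).exists
  refine ⟨K, hK, ?_⟩
  have hKr : (2 : ℝ) ≤ K := by exact_mod_cast hK
  have hsplit : (K : ℝ) ^ ((d : ℝ) - β) = (K : ℝ) ^ (1 - β) * (K : ℝ) ^ (d - 1) := by
    rw [← Real.rpow_natCast (K : ℝ) (d - 1), ← Real.rpow_add (by linarith)]
    congr 1
    push_cast [hd]
    ring
  rw [hsplit, straddlingBound]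
  push_cast
  calc 4 * (((4 : ℝ) ^ d + 1) * (d * 2) * (4 * (2 * K + 4) ^ (d - 1)))
      ≤ 4 * (((4 : ℝ) ^ d + 1) * (d * 2) * (4 * (4 * K) ^ (d - 1))) := by
        gcongr
        linarith
    _ = Q * (K : ℝ) ^ (d - 1) := by rw [hQ, mul_pow]; ring
    _ ≤ _ := by gcongr

theorem proposition17 (d : ℕ) (hd : 1 ≤ d) :
    ∃ Φ : Config d → Site d → Site d,
      IsMatchingRule Φ ∧ IsTranslationEquivariant Φ ∧
        ∃ c : ℝ, 0 < c ∧ ∀ r : ℝ, 2 ≤ r →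
          (coinFlips d).real {γ | r < partnerDist Φ γ} ≤
            c * r ^ (-(1 / (1 + 2 / (d : ℝ)))) * (Real.log r) ^ 2 := by
  have hdr : (1 : ℝ) ≤ d := by exact_mod_cast hd
  set β : ℝ := 1 / (1 + 2 / (d : ℝ)) with hβ
  have hβpos : 0 < β := by positivity
  have hβeq : β = d / (d + 2) := by rw [hβ]; field_simp
  have hβ1 : β < 1 := by rw [hβeq, div_lt_one (by linarith)]; linarith
  have hβd : β ≤ (d : ℝ) / 2 := by
    rw [hβeq]
    exact div_le_div_of_nonneg_left (by linarith) (by norm_num) (by linarith)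
  obtain ⟨K, hK, hKβ⟩ := exists_scale d hβ1 hd
  have hKr : (2 : ℝ) ≤ K := by exact_mod_cast hK
  choose c' hm' hs' hc' using fun k : ℕ =>
    exists_boxClustering d (L := (K : ℤ) ^ k) (by positivity)
  let c : Config d → ℕ → Site d → Site d := fun γ k => c' k γ
  have hm : ∀ k x, Measurable fun γ => c γ k x := hm'
  have hs : ∀ z γ k x, c (shiftConfig z γ) k (x + z) = c γ k x + z := fun z γ k x => hs' k z γ x
  have hc : ∀ γ, Aperiodic γ → ∀ k, IsBoxClustering ((K : ℤ) ^ k) (c γ k) :=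
    fun γ hγ k => hc' k γ hγ
  obtain ⟨D, hD, hbound⟩ := measureReal_unmatched_le hK hm hs hc hβd hβ1.le hKβ
  have hmM : ∀ k x, Measurable fun γ => matchUpTo K γ (coarse (c γ)) k x :=
    measurable_matchUpTo K (measurable_coarse hm)
  have hsM : ∀ z γ k x, matchUpTo K (shiftConfig z γ) (coarse (c (shiftConfig z γ))) k (x + z) =
      matchUpTo K γ (coarse (c γ)) k x + z := fun z γ k x =>
    matchUpTo_shift K γ (coarse_shift (hs z γ)) k x
  have hall : ∀ᵐ γ ∂(coinFlips d), ∀ x, ∃ k, matchUpTo K γ (coarse (c γ)) k x ≠ x := by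
    rw [ae_all_iff]
    intro x
    have hzero : (coinFlips d).real {γ | ¬∃ k, matchUpTo K γ (coarse (c γ)) k x ≠ x} = 0 := by
      have hlim : Filter.Tendsto (fun k : ℕ => D * ((k : ℝ) * ((K : ℝ) ^ (-β)) ^ k))
          Filter.atTop (nhds (D * 0)) :=
        (tendsto_self_mul_const_pow_of_lt_one (by positivity)
          (Real.rpow_lt_one_of_one_lt_of_neg (by linarith) (by linarith))).const_mul D
      rw [mul_zero] at hlim
      refine le_antisymm (ge_of_tendsto hlim ?_) measureReal_nonneg
      filter_upwards [Filter.eventually_ge_atTop 1] with k hk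
      have hsub : {γ | ¬∃ k, matchUpTo K γ (coarse (c γ)) k x ≠ x} ⊆
          {γ | matchUpTo K γ (coarse (c γ)) k x = x} := by
        intro γ hγ
        by_contra hcon
        exact hγ ⟨k, hcon⟩
      have hpow : ((K : ℝ) ^ k) ^ (-β) = ((K : ℝ) ^ (-β)) ^ k := by
        rw [← Real.rpow_natCast, ← Real.rpow_natCast, ← Real.rpow_mul (by positivity),
          ← Real.rpow_mul (by positivity), mul_comm]
      calc _ ≤ _ := measureReal_mono hsub
        _ = _ := measureReal_unmatched_eq hm hs k x
        _ ≤ _ := hbound k hk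
        _ = _ := by rw [hpow, mul_assoc]
    rw [measureReal_eq_zero_iff] at hzero
    exact ae_iff.2 hzero
  refine ⟨fun γ => limitMatch (matchUpTo K γ (coarse (c γ))), ⟨?_, ?_⟩, ?_, ?_⟩
  · exact measurable_from_prod_countable_left fun x => measurable_limitMatch hmM x
  · filter_upwards [hall] with γ hγ
    exact isMatching_limitMatch hγ
  · exact Filter.Eventually.of_forall fun γ z x => limitMatch_shift (hsM z γ) x
  have hlog2 : 0 < Real.log 2 := Real.log_pos (by norm_num)
  refine ⟨(1 + D) * (4 * K) ^ β / Real.log 2 ^ 2, by positivity, fun r hr => ?_⟩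
  have hr0 : 0 < r := by linarith
  have hlogr : Real.log 2 ≤ Real.log r := Real.log_le_log (by norm_num) hr
  have hlogpos : 0 < Real.log r := by linarith
  have hscale : ∀ t : ℝ, t ≤ (1 + D) * (Real.log r / Real.log 2) ^ 2 * (r / (4 * K)) ^ (-β) →
      t ≤ (1 + D) * (4 * K) ^ β / Real.log 2 ^ 2 * r ^ (-β) * (Real.log r) ^ 2 := by
    intro t ht
    refine ht.trans_eq ?_
    rw [Real.div_rpow hr0.le (by positivity), Real.rpow_neg (by positivity : (0 : ℝ) ≤ 4 * K),
      div_pow]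
    field_simp
  have hratio : 1 ≤ Real.log r / Real.log 2 := (one_le_div hlog2).2 hlogr
  have hratio2 : Real.log r / Real.log 2 ≤ (Real.log r / Real.log 2) ^ 2 := by nlinarith
  apply hscale
  rcases lt_or_ge r (4 * K) with hsmall | hlarge
  · have h1 : (1 : ℝ) ≤ (r / (4 * K)) ^ (-β) :=
      Real.one_le_rpow_of_pos_of_le_one_of_nonpos (by positivity)
        ((div_le_one (by positivity)).2 hsmall.le) (by linarith)
    have h2 : 1 ≤ (1 + D) * (Real.log r / Real.log 2) ^ 2 := by nlinarith
    calc _ ≤ (1 : ℝ) := measureReal_le_one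
      _ ≤ _ := by nlinarith
  · set k := Nat.log K ⌊r / 4⌋₊ with hk
    have hfl : K ≤ ⌊r / 4⌋₊ := Nat.le_floor (by linarith)
    have hk1 : 1 ≤ k := Nat.log_pos (by omega) hfl
    have hlow : (K : ℝ) ^ k ≤ r / 4 := by
      have := Nat.pow_log_le_self K (x := ⌊r / 4⌋₊) (by omega)
      calc (K : ℝ) ^ k ≤ (⌊r / 4⌋₊ : ℝ) := by exact_mod_cast this
        _ ≤ _ := Nat.floor_le (by positivity)
    have hup : r / (4 * K) ≤ (K : ℝ) ^ k := by
      have h1 := Nat.lt_pow_succ_log_self (b := K) (by omega) ⌊r / 4⌋₊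
      have h2 : (⌊r / 4⌋₊ : ℝ) + 1 ≤ (K : ℝ) ^ (k + 1) := by exact_mod_cast h1
      have h3 := Nat.lt_floor_add_one (r / 4)
      rw [div_le_iff₀ (by positivity)]
      rw [pow_succ] at h2
      linarith
    have hkr : (k : ℝ) ≤ (Real.log r / Real.log 2) ^ 2 := by
      refine le_trans ?_ hratio2
      rw [le_div_iff₀ hlog2, ← Real.log_pow]
      refine Real.log_le_log (by positivity) ?_
      calc (2 : ℝ) ^ k ≤ (K : ℝ) ^ k := by gcongr
        _ ≤ r := by linarith
    have hsub : (coinFlips d).real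
        {γ | r < partnerDist (fun γ => limitMatch (matchUpTo K γ (coarse (c γ)))) γ} ≤
        (coinFlips d).real {γ | matchUpTo K γ (coarse (c γ)) k 0 = 0} := by
      refine ENNReal.toReal_mono (measure_ne_top _ _) (measure_mono_ae ?_)
      filter_upwards [ae_aperiodic d] with γ hγ hlt
      by_contra hne
      have hnear := limitMatch_near hK (hc γ hγ) (k := k) (x := 0) hne
      refine not_le.2 hlt ?_
      rw [partnerDist, pi_norm_le_iff_of_nonneg hr0.le]
      intro i
      have hi := (hnear i).le
      rw [Pi.zero_apply, sub_zero] at hi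
      rw [Int.norm_eq_abs]
      calc |((limitMatch (matchUpTo K γ (coarse (c γ))) 0 i : ℤ) : ℝ)| ≤ 4 * (K : ℝ) ^ k := by
            exact_mod_cast hi
        _ ≤ r := by linarith
    calc _ ≤ _ := hsub
      _ ≤ _ := hbound k hk1
      _ ≤ (1 + D) * (Real.log r / Real.log 2) ^ 2 * (r / (4 * K)) ^ (-β) := by
        have h1 : ((K : ℝ) ^ k) ^ (-β) ≤ (r / (4 * K)) ^ (-β) :=
          Real.rpow_le_rpow_of_nonpos (by positivity) hup (by linarith)
        gcongr
        linarith
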